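/- Let $n\ge 2$ and let $\mathcal X\subseteq[0,1]^n$ be the set of feasible allocation vectors of a downward-closed permutation environment with $n$ bidders: $\mathcal X$ is nonempty, closed, convex, symmetric (invariant under permutations of the coordinates) and downward-closed ($0\le y\le x$ coordinatewise and $x\in\mathcal X$ imply $y\in\mathcal X$). A deterministic mechanism maps every bid vector $b\in\mathbb R_{\ge0}^n$ to an allocation $x(b)\in\mathcal X$ and payments $p(b)$ with $0\le p_i(b)\le b_i\,x_i(b)$ for every $i$. It is truthful if, for every bidder $i$, every value $v_i$ and all bids of the others, bidding $v_i$ maximizes the utility $v_i x_i-p_i$. A randomized mechanism is a probability distribution over deterministic mechanisms; it is truthful if it is a distribution over truthful ones. A mechanism with predictions is a family $\mathcal M=\{\mathcal M^{\hat v}\}_{\hat v\in\mathbb R_{\ge0}^n}$ of randomized mechanisms, truthful if every $\mathcal M^{\hat v}$ is; $\mathcal M^{\hat v}(v)$ denotes the expected total payment when the bids are $v$. It is $\mu$-consistent against a benchmark $f_1$ if $\mathcal M^{\hat v}(\hat v)\ge f_1(\hat v)/\mu$ for all $\hat v$, and $\alpha$-robust against $f_2$ if $\mathcal M^{\hat v}(v)\ge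 f_2(v)/\alpha$ for all $\hat v,v$. Let $OPT_{\mathcal X}(v)=\max_{x\in\mathcal X}\sum_{i=1}^n x_iv_i$. For $v_1\ge v_2\ge\dots\ge v_n\geq 0$ let $$EFO_{\mathcal X}(v)=\max\Big\{\sum_{i=1}^n\sum_{j=i}^n v_j(x_j-x_{j+1}) : x\in\mathcal X,\ x_1\ge x_2\ge\dots\ge x_n\Big\},\qquad x_{n+1}:=0,$$ and $EFO^{(2)}_{\mathcal X}(v)=EFO_{\mathcal X}(v_2,v_2,v_3,\dots,v_n)$; both are extended to all $v\in\mathbb R_{\ge0}^n$ by first sorting the entries of $v$ in descending order. Then there is a truthful mechanism with predictions, feasible for $\mathcal X$, that is $1$-consistent against $OPT_{\mathcal X}$ and $13.5$-robust against $EFO^{(2)}_{\mathcal X}$. -/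

import Mathlib

open scoped NNReal

namespace CompetitiveAuction

open MeasureTheory

/-- A downward-closed permutation environment with `n` bidders: a nonempty, closed, convex,
symmetric, downward-closed set `X ⊆ [0,1]^n` of feasible allocation vectors. -/
structure IsPermutationEnvironment {n : ℕ} (X : Set (Fin n → ℝ)) : Prop where
  subset_cube : ∀ x ∈ X, ∀ i, 0 ≤ x i ∧ x i ≤ 1
  nonempty : X.Nonempty
  closed : IsClosed X
  convex : Convex ℝ X
  symmetric : ∀ x ∈ X, ∀ π : Equiv.Perm (Fin n), (fun i => x (π i)) ∈ X
  downwardClosed : ∀ x ∈ X, ∀ y : Fin n → ℝ, (∀ i, 0 ≤ y i) → (∀ i, y i ≤ x i) → y ∈ X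

/-- A deterministic (direct, sealed-bid) mechanism with feasibility constraint `X`: to every bid
vector it assigns a feasible allocation vector in `X` (the entry of bidder `i` is the amount, or
probability, of service that `i` receives) and a payment of every bidder. No bidder is ever paid,
and no bidder is charged more than the bid value of the service received (individual
rationality). -/
structure DetMechanism {n : ℕ} (X : Set (Fin n → ℝ)) where
  alloc : (Fin n → ℝ≥0) → Fin n → ℝ
  pay : (Fin n → ℝ≥0) → Fin n → ℝ
  alloc_mem : ∀ b, alloc b ∈ X
  pay_nonneg : ∀ b i, 0 ≤ pay b i
  pay_le : ∀ b i, pay b i ≤ (b i : ℝ) * alloc b i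

/-- Dominant-strategy truthfulness: whatever the others bid, a bidder with value `v i` maximizes
the quasi-linear utility (value times allocation, minus payment) by bidding `v i`. -/
def DetMechanism.IsTruthful {n : ℕ} {X : Set (Fin n → ℝ)} (M : DetMechanism X) : Prop :=
  ∀ (v : Fin n → ℝ≥0) (i : Fin n) (b : ℝ≥0),
    (v i : ℝ) * M.alloc (Function.update v i b) i - M.pay (Function.update v i b) i
      ≤ (v i : ℝ) * M.alloc v i - M.pay v i

/-- A randomized mechanism: a distribution over deterministic mechanisms, given as a family of
deterministic mechanisms indexed by a probability space of coin tosses. -/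
structure RandMechanism {n : ℕ} (X : Set (Fin n → ℝ)) where
  Ω : Type
  [measurableSpace : MeasurableSpace Ω]
  μ : Measure Ω
  [isProbabilityMeasure : IsProbabilityMeasure μ]
  mech : Ω → DetMechanism X
  measurable_alloc : ∀ b i, Measurable fun ω => (mech ω).alloc b i
  measurable_pay : ∀ b i, Measurable fun ω => (mech ω).pay b i

attribute [instance] RandMechanism.measurableSpace RandMechanism.isProbabilityMeasure

/-- A randomized mechanism is truthful if it is a distribution over truthful deterministic
mechanisms. -/
def RandMechanism.IsTruthful {n : ℕ} {X : Set (Fin n → ℝ)} (M : RandMechanism X) : Prop :=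
  ∀ ω, (M.mech ω).IsTruthful

/-- The expected revenue of a randomized mechanism on a bid vector. -/
noncomputable def RandMechanism.revenue {n : ℕ} {X : Set (Fin n → ℝ)} (M : RandMechanism X)
    (v : Fin n → ℝ≥0) : ℝ :=
  ∫ ω, ∑ i, (M.mech ω).pay v i ∂M.μ

/-- A mechanism with predictions: a randomized mechanism for every vector of predicted values. -/
abbrev PredMechanism {n : ℕ} (X : Set (Fin n → ℝ)) : Type 1 := (Fin n → ℝ≥0) → RandMechanism X

/-- Truthfulness of a mechanism with predictions: truthful for every prediction. -/
def PredMechanism.IsTruthful {n : ℕ} {X : Set (Fin n → ℝ)} (M : PredMechanism X) : Prop :=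
  ∀ vhat, (M vhat).IsTruthful

/-- `c`-consistency against the benchmark `f`: `c`-competitive when the prediction is perfect. -/
def PredMechanism.IsConsistent {n : ℕ} {X : Set (Fin n → ℝ)} (M : PredMechanism X) (c : ℝ)
    (f : (Fin n → ℝ≥0) → ℝ) : Prop :=
  ∀ vhat, f vhat / c ≤ (M vhat).revenue vhat

/-- `c`-robustness against the benchmark `f`: `c`-competitive for every prediction. -/
def PredMechanism.IsRobust {n : ℕ} {X : Set (Fin n → ℝ)} (M : PredMechanism X) (c : ℝ)
    (f : (Fin n → ℝ≥0) → ℝ) : Prop :=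
  ∀ vhat v, f v / c ≤ (M vhat).revenue v

/-- The optimal revenue: the maximum over feasible `x` of `∑ i, x i * v i`. -/
noncomputable def OPT {n : ℕ} (X : Set (Fin n → ℝ)) (v : Fin n → ℝ≥0) : ℝ :=
  sSup ((fun x : Fin n → ℝ => ∑ i, x i * (v i : ℝ)) '' X)

/-- The vector `v` rearranged in descending order. -/
noncomputable def sortDesc {n : ℕ} (v : Fin n → ℝ≥0) : Fin n → ℝ≥0 :=
  fun i => v (Tuple.sort (fun j => OrderDual.toDual (v j)) i)

/-- The entry `x_{i+1}`, with the convention `x_{n+1} = 0`. -/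
noncomputable def nextEntry {n : ℕ} (x : Fin n → ℝ) (i : Fin n) : ℝ :=
  if h : i.val + 1 < n then x ⟨i.val + 1, h⟩ else 0

/-- The envy-free revenue of a monotone (descending) allocation `x` on a descending value vector
`v`: bidder `i` pays `∑_{j ≥ i} v_j (x_j - x_{j+1})`. -/
noncomputable def envyFreeRevenue {n : ℕ} (x : Fin n → ℝ) (v : Fin n → ℝ≥0) : ℝ :=
  ∑ i, ∑ j ∈ Finset.Ici i, (v j : ℝ) * (x j - nextEntry x j)

/-- The envy-free optimal revenue: the maximum of the envy-free revenue over all feasible monotone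
allocations, for the value vector rearranged in descending order. -/
noncomputable def EFO {n : ℕ} (X : Set (Fin n → ℝ)) (v : Fin n → ℝ≥0) : ℝ :=
  sSup ((fun x => envyFreeRevenue x (sortDesc v)) '' {x | x ∈ X ∧ Antitone x})

/-- The vector `(v₂, v₂, v₃, …, vₙ)`, where `v₁ ≥ v₂ ≥ … ≥ vₙ` are the entries of `v` in descending
order (index `i : Fin n` stands for the position `i + 1`). -/
noncomputable def replaceTop {n : ℕ} (hn : 2 ≤ n) (v : Fin n → ℝ≥0) : Fin n → ℝ≥0 :=
  fun i => sortDesc v (max i ⟨1, hn⟩)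

/-- The benchmark `EFO⁽²⁾(v) = EFO(v₂, v₂, v₃, …, vₙ)`. -/
noncomputable def EFO2 {n : ℕ} (hn : 2 ≤ n) (X : Set (Fin n → ℝ)) (v : Fin n → ℝ≥0) : ℝ :=
  EFO X (replaceTop hn v)

end CompetitiveAuction

open scoped NNReal

namespace CompetitiveAuction

open MeasureTheory

/-! Offering every bidder a truthful menu that depends only on the other bids gives a truthful
mechanism. Since `X` is convex, averages of feasible systems of menus are feasible, so lotteries
over mechanisms become mixtures of offer rules. For a fixed prediction p, three rules that all earn
OPT at p are mixed with weights 17/27, 6/27 and 4/27; consistency is then immediate.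

`overrideRule` alters, only next to p, an auction that ignores p and is 8-competitive
(`exists_competitive_rule`). That auction mixes a one-winner Vickrey auction with a sampling
auction: every bidder is sampled with probability 1/4, and the others compete at prices and levels
read off the envy-free optimum of the sample. If at every price the unsampled bidders are at least
as numerous as the sampled ones, the sampling auction extracts the envy-free optimum of the sample
(`EFO_masked_le_revenue`). In descending order of values this event says that a biased walk stays
positive. On it, the number of sampled bidders among the top k has expectation at least k/6 - 1/3
(`le_sum_prefixCount`), and the Vickrey auction pays for the deficit.

`postedPredictionRule` earns C, the optimum of p with the entries of the bidders who bid below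
prediction set to zero. Let c be the largest service a single bidder can get and s the
second-highest value. If exactly one bidder is above and exactly one below prediction, `outbidRule`
earns at least c s - C (`le_outbidRule_revenue`).

By `EFO2_le_of_le`, the benchmark is at most C + c s ≤ 2C if v differs from p in one entry, and at
most C + 2 c s if one entry is up and one down. In all remaining cases with v ≠ p the override costs
no revenue (`revenue_le_overrideRule`). The mixture covers each case. -/

/-- A truthful, individually rational take-it-or-leave-it menu for a single bidder, given by the
allocation and the payment as functions of the bid. -/
structure Offer where
  alloc : ℝ≥0 → ℝ
  pay : ℝ≥0 → ℝ
  alloc_nonneg : ∀ z, 0 ≤ alloc z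
  pay_nonneg : ∀ z, 0 ≤ pay z
  pay_le : ∀ z, pay z ≤ z * alloc z
  truthful : ∀ v z : ℝ≥0, v * alloc z - pay z ≤ v * alloc v - pay v

/-! ### Operations on single-bidder menus. -/

namespace Offer

/-- The amount `c` of service is sold to every bid in the upper set `W`, at the infimum of `W`. -/
noncomputable def posted (c : ℝ≥0) (W : UpperSet ℝ≥0) : Offer := by
  classical
  exact
  { alloc := fun z => if z ∈ W then c else 0
    pay := fun z => if z ∈ W then c * (sInf (W : Set ℝ≥0) : ℝ≥0) else 0
    alloc_nonneg := fun z => by split_ifs <;> positivity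
    pay_nonneg := fun z => by split_ifs <;> positivity
    pay_le := fun z => by
      split_ifs with h
      · have : sInf (W : Set ℝ≥0) ≤ z := csInf_le' h
        have : ((sInf (W : Set ℝ≥0) : ℝ≥0) : ℝ) ≤ z := by exact_mod_cast this
        nlinarith [c.2]
      · simp
    truthful := fun v z => by
      have key : z ∈ W → v ∉ W → (v : ℝ) ≤ (sInf (W : Set ℝ≥0) : ℝ≥0) := by
        intro hz hv
        have : v ≤ sInf (W : Set ℝ≥0) := le_csInf ⟨z, hz⟩ fun y hy => by
          by_contra hlt
          exact hv (W.upper (not_le.mp hlt).le hy)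
        exact_mod_cast this
      have key' : v ∈ W → ((sInf (W : Set ℝ≥0) : ℝ≥0) : ℝ) ≤ v := by
        intro hv
        have : sInf (W : Set ℝ≥0) ≤ v := csInf_le' hv
        exact_mod_cast this
      have hc : (0 : ℝ) ≤ c := c.2
      split_ifs with h1 h2 h2
      · exact le_rfl
      · nlinarith [key h1 h2]
      · nlinarith [key' h2]
      · exact le_rfl }

open Classical in
theorem posted_alloc (c : ℝ≥0) (W : UpperSet ℝ≥0) (z : ℝ≥0) :
    (posted c W).alloc z = if z ∈ W then (c : ℝ) else 0 := by
  simp only [posted]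

open Classical in
theorem posted_pay (c : ℝ≥0) (W : UpperSet ℝ≥0) (z : ℝ≥0) :
    (posted c W).pay z = if z ∈ W then (c : ℝ) * (sInf (W : Set ℝ≥0) : ℝ≥0) else 0 := by
  simp only [posted]

theorem le_posted_pay {c : ℝ≥0} {W : UpperSet ℝ≥0} {z t : ℝ≥0} (hz : z ∈ W)
    (ht : ∀ y ∈ W, t ≤ y) : (c : ℝ) * t ≤ (posted c W).pay z := by
  rw [posted_pay, if_pos hz]
  have : t ≤ sInf (W : Set ℝ≥0) := le_csInf ⟨z, hz⟩ ht
  gcongr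

/-- A nonnegative combination of offers. -/
noncomputable def combination {ι : Type*} [Fintype ι] (c : ι → ℝ≥0) (o : ι → Offer) : Offer where
  alloc z := ∑ t, c t * (o t).alloc z
  pay z := ∑ t, c t * (o t).pay z
  alloc_nonneg z := Finset.sum_nonneg fun t _ => mul_nonneg (c t).2 ((o t).alloc_nonneg z)
  pay_nonneg z := Finset.sum_nonneg fun t _ => mul_nonneg (c t).2 ((o t).pay_nonneg z)
  pay_le z := by
    rw [Finset.mul_sum]
    refine Finset.sum_le_sum fun t _ => ?_
    nlinarith [(o t).pay_le z, (c t).2]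
  truthful v z := by
    rw [Finset.mul_sum, Finset.mul_sum, ← Finset.sum_sub_distrib, ← Finset.sum_sub_distrib]
    refine Finset.sum_le_sum fun t _ => ?_
    have := mul_le_mul_of_nonneg_left ((o t).truthful v z) (c t).2
    simp only [NNReal.val_eq_coe] at this
    linarith

/-- The utility of truthful bidding. -/
def util (o : Offer) (z : ℝ≥0) : ℝ := z * o.alloc z - o.pay z

theorem util_mono (o : Offer) {y z : ℝ≥0} (h : y ≤ z) : o.util y ≤ o.util z := by
  have h1 := o.truthful z y
  have h2 : (y : ℝ) ≤ z := by exact_mod_cast h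
  have h3 := mul_le_mul_of_nonneg_right h2 (o.alloc_nonneg y)
  unfold util
  linarith

/-- The offer `o` with bids up to the reserve `r` rejected. -/
noncomputable def withReserve (o : Offer) (r : ℝ≥0) : Offer where
  alloc z := if r < z then o.alloc z else 0
  -- The fee `o.util r` makes a bidder of value `r` indifferent, which keeps the truncated menu
  -- truthful; it is nonnegative, so no accepted bid pays less than before.
  pay z := if r < z then o.pay z + o.util r else 0
  alloc_nonneg z := by split_ifs <;> simp [o.alloc_nonneg]
  pay_nonneg z := by
    split_ifs
    · have := o.pay_le r
      have := o.pay_nonneg z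
      unfold util
      linarith
    · exact le_rfl
  pay_le z := by
    split_ifs with h
    · have := o.util_mono h.le
      unfold util at this ⊢
      linarith
    · simp
  truthful v z := by
    have h1 := o.truthful v z
    split_ifs with hz hv hv
    · linarith
    · have := o.util_mono (not_lt.mp hv)
      unfold util at *
      linarith
    · have := o.util_mono hv.le
      unfold util at *
      linarith
    · exact le_rfl

end Offer

/-! ### Offer rules, their mixtures and their mechanisms. -/

/-- A feasible system of offers, where the offer to a bidder depends on the bids of the others. -/
structure OfferRule {n : ℕ} (X : Set (Fin n → ℝ)) where
  offer : Fin n → (Fin n → ℝ≥0) → Offer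
  offer_update : ∀ i b z, offer i (Function.update b i z) = offer i b
  feasible : ∀ b, (fun i => (offer i b).alloc (b i)) ∈ X

namespace OfferRule

variable {n : ℕ} {X : Set (Fin n → ℝ)}

/-- The revenue of an offer rule. -/
noncomputable def revenue (R : OfferRule X) (v : Fin n → ℝ≥0) : ℝ :=
  ∑ i, (R.offer i v).pay (v i)

theorem revenue_nonneg (R : OfferRule X) (v : Fin n → ℝ≥0) : 0 ≤ R.revenue v :=
  Finset.sum_nonneg fun i _ => (R.offer i v).pay_nonneg _

/-- A convex combination of offer rules. -/
noncomputable def mix (hX : Convex ℝ X) {ι : Type*} [Fintype ι] (c : ι → ℝ≥0)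
    (hc : ∑ t, c t = 1) (R : ι → OfferRule X) : OfferRule X where
  offer i b := Offer.combination c fun t => (R t).offer i b
  offer_update i b z := by simp only [(R _).offer_update]
  feasible b := by
    have h : ∑ t, (c t : ℝ) • (fun i => ((R t).offer i b).alloc (b i)) ∈ X :=
      hX.sum_mem (fun t _ => (c t).2) (by exact_mod_cast hc) fun t _ => (R t).feasible b
    convert h using 1
    ext i
    simp [Offer.combination]

theorem revenue_mix (hX : Convex ℝ X) {ι : Type*} [Fintype ι] (c : ι → ℝ≥0)
    (hc : ∑ t, c t = 1) (R : ι → OfferRule X) (v : Fin n → ℝ≥0) :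
    (mix hX c hc R).revenue v = ∑ t, c t * (R t).revenue v := by
  simp only [revenue, mix, Offer.combination, Finset.mul_sum]
  exact Finset.sum_comm

/-- The deterministic mechanism of an offer rule. -/
noncomputable def toDet (R : OfferRule X) : DetMechanism X where
  alloc b i := (R.offer i b).alloc (b i)
  pay b i := (R.offer i b).pay (b i)
  alloc_mem := R.feasible
  pay_nonneg b i := (R.offer i b).pay_nonneg _
  pay_le b i := (R.offer i b).pay_le _

theorem toDet_isTruthful (R : OfferRule X) : R.toDet.IsTruthful := by
  intro v i z
  simp only [toDet, R.offer_update, Function.update_self]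
  exact (R.offer i v).truthful _ _

/-- The randomized mechanism that always runs the same offer rule. -/
noncomputable def toRand (R : OfferRule X) : RandMechanism X where
  Ω := Unit
  μ := Measure.dirac ()
  mech _ := R.toDet
  measurable_alloc _ _ := measurable_const
  measurable_pay _ _ := measurable_const

theorem toRand_revenue (R : OfferRule X) (v : Fin n → ℝ≥0) : R.toRand.revenue v = R.revenue v := by
  change ∫ _ : Unit, R.revenue v ∂(Measure.dirac ()) = _
  rw [integral_dirac]

end OfferRule

/-! ### Order statistics and envy-free revenue. -/

theorem sortDesc_antitone {n : ℕ} (v : Fin n → ℝ≥0) : Antitone (sortDesc v) := by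
  intro i j hij
  exact Tuple.monotone_sort (fun j => OrderDual.toDual (v j)) hij

theorem card_filter_sortDesc {n : ℕ} (v : Fin n → ℝ≥0) (p : ℝ≥0 → Prop) [DecidablePred p] :
    (Finset.univ.filter fun i => p (sortDesc v i)).card
      = (Finset.univ.filter fun i => p (v i)).card := by
  refine Finset.card_equiv (Tuple.sort fun j => OrderDual.toDual (v j)) fun i => ?_
  rw [Finset.mem_filter, Finset.mem_filter]
  simp only [Finset.mem_univ, true_and]
  exact Iff.rfl

theorem Antitone.le_apply_iff {n : ℕ} {w : Fin n → ℝ≥0} (hw : Antitone w) (t : ℝ≥0) (k : Fin n) :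
    t ≤ w k ↔ k.val + 1 ≤ (Finset.univ.filter fun i => t ≤ w i).card := by
  constructor
  · intro h
    rw [← Fin.card_Iic]
    refine Finset.card_le_card fun i hi => ?_
    simp only [Finset.mem_filter, Finset.mem_univ, true_and]
    exact h.trans (hw (Finset.mem_Iic.mp hi))
  · intro h
    by_contra hk
    have : (Finset.univ.filter fun i => t ≤ w i) ⊆ Finset.Iio k := by
      intro i hi
      simp only [Finset.mem_filter, Finset.mem_univ, true_and] at hi
      rw [Finset.mem_Iio]
      by_contra hik
      exact hk (hi.trans (hw (not_lt.mp hik)))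
    have := Finset.card_le_card this
    rw [Fin.card_Iio] at this
    omega

/-- Sorting preserves the number of values above a threshold, and in a descending vector these fill
an initial segment. This turns order statistics into counts. -/
theorem le_sortDesc_iff {n : ℕ} (v : Fin n → ℝ≥0) (t : ℝ≥0) (k : Fin n) :
    t ≤ sortDesc v k ↔ k.val + 1 ≤ (Finset.univ.filter fun i => t ≤ v i).card := by
  rw [Antitone.le_apply_iff (sortDesc_antitone v), card_filter_sortDesc v (fun x => t ≤ x)]

theorem sortDesc_of_antitone {n : ℕ} {w : Fin n → ℝ≥0} (hw : Antitone w) : sortDesc w = w := by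
  funext k
  refine eq_of_forall_le_iff fun t => ?_
  rw [le_sortDesc_iff, Antitone.le_apply_iff hw]

theorem exists_ne_second_le {n : ℕ} (hn : 2 ≤ n) (v : Fin n → ℝ≥0) (i : Fin n) :
    ∃ k, k ≠ i ∧ sortDesc v ⟨1, hn⟩ ≤ v k := by
  have h := (le_sortDesc_iff v (sortDesc v ⟨1, hn⟩) ⟨1, hn⟩).mp le_rfl
  obtain ⟨k, hk, hki⟩ := Finset.exists_mem_ne h i
  exact ⟨k, hki, by simpa using hk⟩

theorem nextEntry_le {n : ℕ} {x : Fin n → ℝ} (hx : Antitone x) (h0 : ∀ i, 0 ≤ x i) (i : Fin n) :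
    nextEntry x i ≤ x i := by
  unfold nextEntry
  split_ifs with h
  · exact hx (by rw [Fin.le_def]; simp)
  · exact h0 i

theorem sum_Ici_sub_nextEntry {n : ℕ} (x : Fin n → ℝ) (i : Fin n) :
    ∑ j ∈ Finset.Ici i, (x j - nextEntry x j) = x i := by
  let y : ℕ → ℝ := fun k => if h : k < n then x ⟨k, h⟩ else 0
  have h1 : ∑ j ∈ Finset.Ici i, (x j - nextEntry x j)
      = ∑ k ∈ Finset.Ico i.val n, (y k - y (k + 1)) := by
    refine Finset.sum_bij (fun j _ => j.val) ?_ ?_ ?_ ?_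
    · intro j hj
      simpa using hj
    · intro a _ b _ h
      exact Fin.ext h
    · intro k hk
      rw [Finset.mem_Ico] at hk
      exact ⟨⟨k, hk.2⟩, by simpa [Fin.le_def] using hk.1, rfl⟩
    · intro j _
      simp [y, nextEntry]
  have h2 : ∑ k ∈ Finset.Ico i.val n, (y k - y (k + 1)) = y i - y n := by
    have := Finset.sum_Ico_sub y i.isLt.le
    rw [← neg_sub (y n), ← this, ← Finset.sum_neg_distrib]
    simp
  rw [h1, h2]
  simp [y]

/-- Exchanging the two sums splits the revenue into levels: level j sells to the top j + 1 bidders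
at the uniform price `v j`, weighted by the drop of `x` after j. Revenues are later compared level
by level. -/
theorem envyFreeRevenue_eq {n : ℕ} (x : Fin n → ℝ) (v : Fin n → ℝ≥0) :
    envyFreeRevenue x v = ∑ j, (x j - nextEntry x j) * ((j.val + 1 : ℕ) * v j) := by
  unfold envyFreeRevenue
  rw [Finset.sum_comm' (t' := Finset.univ) (s' := fun j => Finset.Iic j) (by simp)]
  refine Finset.sum_congr rfl fun j _ => ?_
  rw [Finset.sum_const, Fin.card_Iic, nsmul_eq_mul]
  ring

theorem envyFreeRevenue_le {n : ℕ} {x : Fin n → ℝ} (hx : Antitone x) (h0 : ∀ i, 0 ≤ x i)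
    {v : Fin n → ℝ≥0} (hv : Antitone v) : envyFreeRevenue x v ≤ ∑ i, x i * v i := by
  unfold envyFreeRevenue
  refine Finset.sum_le_sum fun i _ => ?_
  rw [← sum_Ici_sub_nextEntry x i, Finset.sum_mul]
  refine Finset.sum_le_sum fun j hj => ?_
  have h1 : (v j : ℝ) ≤ v i := by exact_mod_cast hv (Finset.mem_Ici.mp hj)
  have h2 := nextEntry_le hx h0 j
  nlinarith

/-! ### Compactness and symmetry of the feasible set. -/

namespace IsPermutationEnvironment

variable {n : ℕ} {X : Set (Fin n → ℝ)}

theorem zero_mem (hX : IsPermutationEnvironment X) : (fun _ => 0) ∈ X := by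
  obtain ⟨x, hx⟩ := hX.nonempty
  exact hX.downwardClosed x hx _ (fun _ => le_rfl) fun i => (hX.subset_cube x hx i).1

theorem isCompact (hX : IsPermutationEnvironment X) : IsCompact X :=
  (isCompact_Icc (a := (0 : Fin n → ℝ)) (b := 1)).of_isClosed_subset hX.closed
    fun x hx => ⟨fun i => (hX.subset_cube x hx i).1, fun i => (hX.subset_cube x hx i).2⟩

theorem continuous_welfare (v : Fin n → ℝ≥0) :
    Continuous fun x : Fin n → ℝ => ∑ i, x i * (v i : ℝ) := by fun_prop

theorem le_OPT (hX : IsPermutationEnvironment X) {x : Fin n → ℝ} (hx : x ∈ X) (v : Fin n → ℝ≥0) :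
    ∑ i, x i * (v i : ℝ) ≤ OPT X v :=
  le_csSup (hX.isCompact.image (continuous_welfare v)).bddAbove ⟨x, hx, rfl⟩

theorem exists_OPT (hX : IsPermutationEnvironment X) (v : Fin n → ℝ≥0) :
    ∃ x ∈ X, ∑ i, x i * (v i : ℝ) = OPT X v :=
  (hX.isCompact.image (continuous_welfare v)).sSup_mem (hX.nonempty.image _)

theorem isCompact_antitone (hX : IsPermutationEnvironment X) :
    IsCompact {x | x ∈ X ∧ Antitone x} :=
  hX.isCompact.inter_right isClosed_antitone

theorem continuous_envyFreeRevenue (u : Fin n → ℝ≥0) :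
    Continuous fun x : Fin n → ℝ => envyFreeRevenue x u := by
  have h : ∀ i : Fin n, Continuous fun x : Fin n → ℝ => nextEntry x i := by
    intro i
    unfold nextEntry
    split_ifs <;> fun_prop
  unfold envyFreeRevenue
  fun_prop

theorem le_EFO (hX : IsPermutationEnvironment X) {x : Fin n → ℝ} (hx : x ∈ X) (ha : Antitone x)
    (v : Fin n → ℝ≥0) : envyFreeRevenue x (sortDesc v) ≤ EFO X v :=
  le_csSup (hX.isCompact_antitone.image (continuous_envyFreeRevenue _)).bddAbove
    ⟨x, ⟨hx, ha⟩, rfl⟩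

theorem exists_EFO (hX : IsPermutationEnvironment X) (v : Fin n → ℝ≥0) :
    ∃ x, x ∈ X ∧ Antitone x ∧ envyFreeRevenue x (sortDesc v) = EFO X v := by
  obtain ⟨x, ⟨h1, h2⟩, h3⟩ :=
    (hX.isCompact_antitone.image (continuous_envyFreeRevenue (sortDesc v))).sSup_mem
      (Set.Nonempty.image _ ⟨_, hX.zero_mem, antitone_const⟩)
  exact ⟨x, h1, h2, h3⟩

/-- The largest amount of service that can be given to a single bidder. -/
theorem exists_max_service (hX : IsPermutationEnvironment X) (hn : 0 < n) :
    ∃ c : ℝ≥0, (∀ x ∈ X, ∀ i, x i ≤ c) ∧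
      ∀ (i : Fin n) (y : Fin n → ℝ), (∀ k, 0 ≤ y k) → (∀ k, k ≠ i → y k = 0) → y i ≤ c → y ∈ X := by
  obtain ⟨x, hx, hmax⟩ := hX.isCompact.exists_isMaxOn hX.nonempty
    (continuous_apply (⟨0, hn⟩ : Fin n)).continuousOn
  refine ⟨⟨x ⟨0, hn⟩, (hX.subset_cube x hx _).1⟩, fun y hy i => ?_, fun i y h0 hne hle => ?_⟩
  · have := hmax (hX.symmetric y hy (Equiv.swap ⟨0, hn⟩ i))
    simp only [Set.mem_ofPred_eq, Equiv.swap_apply_left] at this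
    exact this
  · refine hX.downwardClosed _ (hX.symmetric x hx (Equiv.swap ⟨0, hn⟩ i)) y h0 fun k => ?_
    by_cases hk : k = i
    · subst hk
      simp only [Equiv.swap_apply_right]
      exact hle
    · rw [hne k hk]
      exact (hX.subset_cube x hx _).1

/-- A partial injection of a finite type extends to a permutation, so `y` lies below a rearrangement
of `x`. -/
theorem mem_of_injOn (hX : IsPermutationEnvironment X) {x : Fin n → ℝ} (hx : x ∈ X)
    {s : Set (Fin n)} {f : Fin n → Fin n} (hf : Set.InjOn f s) {y : Fin n → ℝ}
    (h0 : ∀ i, 0 ≤ y i) (hs : ∀ i ∉ s, y i = 0) (hle : ∀ i ∈ s, y i ≤ x (f i)) : y ∈ X := by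
  obtain ⟨g, hg⟩ := Set.MapsTo.exists_equiv_extend_of_card_eq (t := (Finset.univ : Finset (Fin n)))
    (s := s) (f := f) (by simp) (fun _ _ => by simp) hf
  let π : Equiv.Perm (Fin n) := g.trans (Equiv.subtypeUnivEquiv (by simp))
  have hπ : ∀ i ∈ s, π i = f i := fun i hi => hg i hi
  refine hX.downwardClosed _ (hX.symmetric x hx π) y h0 fun i => ?_
  by_cases hi : i ∈ s
  · rw [hπ i hi]
    exact hle i hi
  · rw [hs i hi]
    exact (hX.subset_cube x hx _).1

end IsPermutationEnvironment

theorem replaceTop_antitone {n : ℕ} (hn : 2 ≤ n) (v : Fin n → ℝ≥0) : Antitone (replaceTop hn v) :=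
  fun _ _ h => sortDesc_antitone v (max_le_max h le_rfl)

theorem replaceTop_eq_min {n : ℕ} (hn : 2 ≤ n) (v : Fin n → ℝ≥0) (i : Fin n) :
    replaceTop hn v i = min (sortDesc v i) (sortDesc v ⟨1, hn⟩) :=
  (sortDesc_antitone v).map_max

/-- Envy-free revenue is at most welfare, and lowering the top value to the second caps every value
there; undoing the sort is harmless by symmetry. -/
theorem EFO2_le_OPT_min {n : ℕ} (hn : 2 ≤ n) {X : Set (Fin n → ℝ)}
    (hX : IsPermutationEnvironment X) (v : Fin n → ℝ≥0) :
    EFO2 hn X v ≤ OPT X fun i => min (v i) (sortDesc v ⟨1, hn⟩) := by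
  obtain ⟨x, hx, ha, he⟩ := hX.exists_EFO (replaceTop hn v)
  unfold EFO2
  rw [← he, sortDesc_of_antitone (replaceTop_antitone hn v)]
  refine (envyFreeRevenue_le ha (fun i => (hX.subset_cube x hx i).1)
    (replaceTop_antitone hn v)).trans ?_
  let σ := Tuple.sort fun j => OrderDual.toDual (v j)
  have h := hX.le_OPT (hX.symmetric x hx σ.symm) fun i => min (v i) (sortDesc v ⟨1, hn⟩)
  refine le_trans (le_of_eq ?_) h
  rw [← Equiv.sum_comp σ fun i => x (σ.symm i) * ((min (v i) (sortDesc v ⟨1, hn⟩) : ℝ≥0) : ℝ)]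
  refine Finset.sum_congr rfl fun i _ => ?_
  rw [replaceTop_eq_min]
  simp [σ, sortDesc]

/-! ### A biased random walk and gambler's ruin. -/

/-- The number of entries equal to `a` among the first `j` entries of `s`. -/
def prefixCount {t : ℕ} (a : Bool) (s : Fin t → Bool) (j : ℕ) : ℕ :=
  (Finset.univ.filter fun k : Fin t => k.val < j ∧ s k = a).card

theorem prefixCount_zero {t : ℕ} (a : Bool) (s : Fin t → Bool) : prefixCount a s 0 = 0 := by
  simp [prefixCount]

theorem prefixCount_cons {t : ℕ} (a b : Bool) (s : Fin t → Bool) (j : ℕ) :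
    prefixCount a (Fin.cons b s : Fin (t + 1) → Bool) (j + 1)
      = (if b = a then 1 else 0) + prefixCount a s j := by
  unfold prefixCount
  rw [Fin.card_filter_univ_succ']
  simp

theorem prefixCount_le {t : ℕ} (a : Bool) (s : Fin t → Bool) (j : ℕ) : prefixCount a s j ≤ j := by
  refine (Finset.card_le_card (t := Finset.univ.filter fun k : Fin t => k.val < j) ?_).trans ?_
  · intro k
    simp +contextual
  · rw [Fin.card_filter_val_lt]
    exact min_le_right _ _

/-- The walk that starts at `m`, steps down at `true` and up at `false`, stays positive. -/
def StaysPositive {t : ℕ} (m : ℕ) (s : Fin t → Bool) : Prop :=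
  ∀ j, prefixCount true s j < m + prefixCount false s j

theorem not_staysPositive_zero {t : ℕ} (s : Fin t → Bool) : ¬ StaysPositive 0 s := by
  intro h
  simpa [prefixCount_zero] using h 0

theorem staysPositive_cons_true {t : ℕ} (m : ℕ) (s : Fin t → Bool) :
    StaysPositive (m + 1) (Fin.cons true s : Fin (t + 1) → Bool) ↔ StaysPositive m s := by
  constructor
  · intro h j
    have := h (j + 1)
    simp only [prefixCount_cons] at this
    simp at this
    omega
  · intro h j
    cases j with
    | zero => simp [prefixCount_zero]
    | succ j =>
      have := h j
      simp only [prefixCount_cons]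
      simp
      omega

theorem staysPositive_cons_false {t : ℕ} (m : ℕ) (s : Fin t → Bool) :
    StaysPositive (m + 1) (Fin.cons false s : Fin (t + 1) → Bool) ↔ StaysPositive (m + 2) s := by
  constructor
  · intro h j
    have := h (j + 1)
    simp only [prefixCount_cons] at this
    simp at this
    omega
  · intro h j
    cases j with
    | zero => simp [prefixCount_zero]
    | succ j =>
      have := h j
      simp only [prefixCount_cons]
      simp
      omega

/-- The probability of the sample `s` when every entry is `true` with probability `1 / 4`. -/
noncomputable def sampleWeight {t : ℕ} (s : Fin t → Bool) : ℝ≥0 :=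
  ∏ k, if s k = true then 1 / 4 else 3 / 4

theorem sampleWeight_cons {t : ℕ} (b : Bool) (s : Fin t → Bool) :
    sampleWeight (Fin.cons b s : Fin (t + 1) → Bool)
      = (if b = true then 1 / 4 else 3 / 4) * sampleWeight s := by
  simp [sampleWeight, Fin.prod_univ_succ]

theorem sum_bool_cons {t : ℕ} (f : (Fin (t + 1) → Bool) → ℝ) :
    ∑ s, f s = ∑ s : Fin t → Bool, f (Fin.cons true s) + ∑ s : Fin t → Bool, f (Fin.cons false s) := by
  rw [← (Fin.consEquiv fun _ : Fin (t + 1) => Bool).sum_comp, Fintype.sum_prod_type]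
  simp [Fin.consEquiv]

theorem sum_sampleWeight (t : ℕ) : ∑ s : Fin t → Bool, sampleWeight s = 1 := by
  have : ∑ s : Fin t → Bool, (sampleWeight s : ℝ) = 1 := by
    induction t with
    | zero => simp [sampleWeight]
    | succ t ih =>
      rw [sum_bool_cons]
      simp only [sampleWeight_cons]
      push_cast
      rw [← Finset.mul_sum, ← Finset.mul_sum, ih]
      norm_num
  exact_mod_cast this

-- Gambler's ruin: with down-probability 1/4 the infinite walk from m is ruined with probability
-- (1/3)^m, and a finite horizon can only help. The bound solves the first-step recursion exactly,
-- hence the induction on t.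
open Classical in
theorem le_sum_staysPositive (t m : ℕ) :
    1 - (1 / 3 : ℝ) ^ m 
      ≤ ∑ s : Fin t → Bool, (sampleWeight s : ℝ) * if StaysPositive m s then 1 else 0 := by
  induction t generalizing m with
  | zero =>
    cases m with
    | zero => simp [not_staysPositive_zero]
    | succ m =>
      have : ∀ s : Fin 0 → Bool, StaysPositive (m + 1) s := by
        intro s j
        simp [prefixCount]
      simp [this, sampleWeight]
  | succ t ih =>
    cases m with
    | zero => simp [not_staysPositive_zero]
    | succ m =>
      rw [sum_bool_cons]
      simp only [sampleWeight_cons, staysPositive_cons_true, staysPositive_cons_false]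
      push_cast
      simp only [mul_assoc]
      rw [← Finset.mul_sum, ← Finset.mul_sum]
      have h1 := ih m
      have h2 := ih (m + 2)
      rw [show (1 / 3 : ℝ) ^ (m + 2) = (1 / 3) ^ m / 9 by ring] at h2
      rw [show (1 / 3 : ℝ) ^ (m + 1) = (1 / 3) ^ m / 3 by ring]
      linarith

open Classical in
/-- The expected number of `true` entries among the first `j`, on the event that the walk that
starts at `m` stays positive. -/
theorem le_sum_prefixCount (t m j : ℕ) (hj : j ≤ t) :
    (1 - (1 / 3 : ℝ) ^ m) * (j / 4) - m * (1 / 3) ^ m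
      ≤ ∑ s : Fin t → Bool,
        (sampleWeight s : ℝ) * if StaysPositive m s then (prefixCount true s j : ℝ) else 0 := by
  induction t generalizing m j with
  | zero =>
    obtain rfl : j = 0 := by omega
    simp [prefixCount_zero]
  | succ t ih =>
    cases m with
    | zero => simp [not_staysPositive_zero]
    | succ m =>
      cases j with
      | zero =>
        simp [prefixCount_zero]
        positivity
      | succ j =>
        rw [sum_bool_cons]
        simp only [sampleWeight_cons, staysPositive_cons_true, staysPositive_cons_false,
          prefixCount_cons]
        push_cast
        simp only [mul_assoc]
        rw [← Finset.mul_sum, ← Finset.mul_sum]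
        -- The claimed bound solves the first-step recursion exactly: a down-step adds 1 to the
        -- count on survival, which is why the survival bound `h3` enters.
        have h1 := ih m j (by omega)
        have h2 := ih (m + 2) j (by omega)
        have h3 := le_sum_staysPositive t m
        have h4 : ∑ s : Fin t → Bool, (sampleWeight s : ℝ) *
              (if StaysPositive m s then (1 + (prefixCount true s j : ℝ)) else 0)
            = (∑ s : Fin t → Bool, (sampleWeight s : ℝ) * if StaysPositive m s then 1 else 0)
            + ∑ s : Fin t → Bool, (sampleWeight s : ℝ) *
              if StaysPositive m s then (prefixCount true s j : ℝ) else 0 := by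
          rw [← Finset.sum_add_distrib]
          refine Finset.sum_congr rfl fun s _ => ?_
          split_ifs <;> ring
        simp only [zero_add]
        rw [h4]
        push_cast at h2
        have e : (1 / 3 : ℝ) ^ (m + 2) = (1 / 3) ^ m / 9 := by ring
        have e' : (1 / 3 : ℝ) ^ (m + 1) = (1 / 3) ^ m / 3 := by ring
        rw [e] at h2
        rw [e']
        linarith

/-! ### Ranks and Vickrey auctions outside the sample. -/

variable {n : ℕ}

/-- The number of competitors of `i` outside the sample `s` that outrank the bid `z` of `i`; ties
are broken in favour of the smaller index. -/
noncomputable def rank (s : Fin n → Bool) (b : Fin n → ℝ≥0) (i : Fin n) (z : ℝ≥0) : ℕ :=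
  (Finset.univ.filter fun k => s k = false ∧ k ≠ i ∧ (z < b k ∨ (z = b k ∧ k < i))).card

theorem rank_antitone (s : Fin n → Bool) (b : Fin n → ℝ≥0) (i : Fin n) :
    Antitone (rank s b i) := by
  intro y z hyz
  refine Finset.card_le_card fun k => ?_
  simp only [Finset.mem_filter, Finset.mem_univ, true_and]
  rintro ⟨h1, h2, h3 | ⟨h3, h4⟩⟩
  · exact ⟨h1, h2, Or.inl (hyz.trans_lt h3)⟩
  · rcases hyz.lt_or_eq with h | h
    · exact ⟨h1, h2, Or.inl (h3 ▸ h)⟩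
    · exact ⟨h1, h2, Or.inr ⟨h.trans h3, h4⟩⟩

theorem rank_update (s : Fin n → Bool) (b : Fin n → ℝ≥0) (i : Fin n) (y : ℝ≥0) :
    rank s (Function.update b i y) i = rank s b i := by
  funext z
  unfold rank
  congr 1
  refine Finset.filter_congr fun k _ => ?_
  by_cases hk : k = i
  · simp [hk]
  · simp [Function.update_of_ne hk]

theorem rank_lt_card (s : Fin n → Bool) (b : Fin n → ℝ≥0) {t : ℝ≥0} {i : Fin n}
    (hs : s i = false) (ht : t ≤ b i) :
    rank s b i (b i) < (Finset.univ.filter fun k => s k = false ∧ t ≤ b k).card := by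
  refine Finset.card_lt_card ⟨fun k => ?_, fun h => ?_⟩
  · simp only [Finset.mem_filter, Finset.mem_univ, true_and]
    rintro ⟨h1, -, h3 | ⟨h3, -⟩⟩
    · exact ⟨h1, ht.trans h3.le⟩
    · exact ⟨h1, ht.trans h3.le⟩
  · have := @h i (by simp [hs, ht])
    simp at this

theorem rank_lt (s : Fin n → Bool) (b : Fin n → ℝ≥0) {i : Fin n} (hs : s i = false) :
    rank s b i (b i) < n :=
  (rank_lt_card s b hs (zero_le : 0 ≤ b i)).trans_le
    ((Finset.card_le_univ _).trans_eq (Fintype.card_fin n))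

theorem rank_injOn (s : Fin n → Bool) (b : Fin n → ℝ≥0) :
    Set.InjOn (fun i => rank s b i (b i)) {i | s i = false} := by
  have key : ∀ i k : Fin n, s k = false → k ≠ i → (b i < b k ∨ (b i = b k ∧ k < i)) →
      rank s b k (b k) < rank s b i (b i) := by
    intro i k hk hki hb
    refine Finset.card_lt_card ⟨fun l => ?_, fun h => ?_⟩
    · simp only [Finset.mem_filter, Finset.mem_univ, true_and]
      rintro ⟨h1, -, h3⟩
      have h4 : b i < b l ∨ (b i = b l ∧ l < i) := by
        rcases hb with hb | ⟨hb, hb'⟩ <;> rcases h3 with h3 | ⟨h3, h3'⟩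
        · exact Or.inl (hb.trans h3)
        · exact Or.inl (h3 ▸ hb)
        · exact Or.inl (hb ▸ h3)
        · exact Or.inr ⟨hb.trans h3, h3'.trans hb'⟩
      refine ⟨h1, ?_, h4⟩
      rintro rfl
      simp at h4
    · have := @h k (by simp [hk, hki, hb])
      simp at this
  intro i hi k hk h
  by_contra hne
  rcases lt_trichotomy (b i) (b k) with hb | hb | hb
  · exact (key i k hk (Ne.symm hne) (Or.inl hb)).ne h.symm
  · rcases lt_or_gt_of_ne hne with hlt | hlt
    · exact (key k i hi hne (Or.inr ⟨hb.symm, hlt⟩)).ne h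
    · exact (key i k hk (Ne.symm hne) (Or.inr ⟨hb, hlt⟩)).ne h.symm
  · exact (key k i hi hne (Or.inl hb)).ne h

/-- The unsampled bidders at or above `t` have distinct ranks, all smaller than their number, so
these ranks fill an initial segment and each of 0, …, j is attained. -/
theorem le_card_rank_le (s : Fin n → Bool) (b : Fin n → ℝ≥0) (t : ℝ≥0) (j : ℕ)
    (hj : j + 1 ≤ (Finset.univ.filter fun k => s k = false ∧ t ≤ b k).card) :
    j + 1 ≤ (Finset.univ.filter fun i =>
      s i = false ∧ t ≤ b i ∧ rank s b i (b i) ≤ j).card := by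
  set T := Finset.univ.filter fun k => s k = false ∧ t ≤ b k with hT
  have himg : T.image (fun i => rank s b i (b i)) = Finset.range T.card := by
    refine Finset.eq_of_subset_of_card_le (fun r hr => ?_) ?_
    · obtain ⟨i, hi, rfl⟩ := Finset.mem_image.mp hr
      rw [hT] at hi
      simp only [Finset.mem_filter, Finset.mem_univ, true_and] at hi
      exact Finset.mem_range.mpr (rank_lt_card s b hi.1 hi.2)
    · rw [Finset.card_image_of_injOn, Finset.card_range]
      refine (rank_injOn s b).mono fun i hi => ?_
      rw [hT] at hi
      simp only [Finset.coe_filter, Finset.mem_univ, true_and] at hi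
      exact hi.1
  rw [← Finset.card_range (j + 1)]
  refine (Finset.card_le_card fun r hr => ?_).trans
    (Finset.card_image_le (f := fun i => rank s b i (b i)))
  have hr' : r ∈ T.image fun i => rank s b i (b i) := by
    rw [himg, Finset.mem_range]
    exact (Finset.mem_range.mp hr).trans_le hj
  obtain ⟨i, hi, rfl⟩ := Finset.mem_image.mp hr'
  rw [hT] at hi
  simp only [Finset.mem_filter, Finset.mem_univ, true_and] at hi
  refine Finset.mem_image.mpr ⟨i, ?_, rfl⟩
  simp only [Finset.mem_filter, Finset.mem_univ, true_and]
  exact ⟨hi.1, hi.2, Nat.lt_succ_iff.mp (Finset.mem_range.mp hr)⟩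

/-- The winning bids of bidder `i` in the `(j + 1)`-unit Vickrey auction with reserve price `t`
among the bidders outside the sample `s`. -/
noncomputable def winningBids (s : Fin n → Bool) (b : Fin n → ℝ≥0) (i : Fin n) (t : ℝ≥0) (j : ℕ) :
    UpperSet ℝ≥0 where
  carrier := {z | t ≤ z ∧ rank s b i z ≤ j}
  upper' := fun _ _ hyz hy => ⟨hy.1.trans hyz, (rank_antitone s b i hyz).trans hy.2⟩

theorem mem_winningBids {s : Fin n → Bool} {b : Fin n → ℝ≥0} {i : Fin n} {t : ℝ≥0} {j : ℕ}
    {z : ℝ≥0} : z ∈ winningBids s b i t j ↔ t ≤ z ∧ rank s b i z ≤ j := Iff.rfl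

theorem winningBids_update (s : Fin n → Bool) (b : Fin n → ℝ≥0) (i : Fin n) (y : ℝ≥0) :
    winningBids s (Function.update b i y) i = winningBids s b i := by
  funext t j
  refine SetLike.ext fun z => ?_
  rw [mem_winningBids, mem_winningBids, rank_update]

/-! ### The sampling auction. -/

/-- The bids of the sampled bidders. -/
noncomputable def masked (s : Fin n → Bool) (b : Fin n → ℝ≥0) : Fin n → ℝ≥0 :=
  fun i => if s i = true then b i else 0

theorem masked_update {s : Fin n → Bool} {i : Fin n} (hs : ¬ s i = true) (b : Fin n → ℝ≥0)
    (y : ℝ≥0) : masked s (Function.update b i y) = masked s b := by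
  funext k
  unfold masked
  by_cases hk : k = i
  · subst hk
    simp [hs]
  · rw [Function.update_of_ne hk]

/-- An envy-free optimal allocation. -/
noncomputable def efoAlloc {X : Set (Fin n → ℝ)} (hX : IsPermutationEnvironment X)
    (v : Fin n → ℝ≥0) : Fin n → ℝ :=
  Classical.choose (hX.exists_EFO v)

theorem efoAlloc_spec {X : Set (Fin n → ℝ)} (hX : IsPermutationEnvironment X)
    (v : Fin n → ℝ≥0) : efoAlloc hX v ∈ X ∧ Antitone (efoAlloc hX v) ∧
      envyFreeRevenue (efoAlloc hX v) (sortDesc v) = EFO X v :=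
  Classical.choose_spec (hX.exists_EFO v)

/-- The probability that an allocation serves exactly the `j + 1` highest bidders. -/
noncomputable def levelWeight (x : Fin n → ℝ) (j : Fin n) : ℝ≥0 :=
  (x j - nextEntry x j).toNNReal

theorem coe_levelWeight {x : Fin n → ℝ} (hx : Antitone x) (h0 : ∀ i, 0 ≤ x i) (j : Fin n) :
    (levelWeight x j : ℝ) = x j - nextEntry x j :=
  Real.coe_toNNReal _ (sub_nonneg.mpr (nextEntry_le hx h0 j))

/-- Bidders in the sample `s` get nothing; the others take part, for every level `j`, in a
`(j + 1)`-unit Vickrey auction whose reserve price is the `j`-th highest sampled bid, weighted as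
in the envy-free optimal allocation of the sample. -/
noncomputable def samplingRule {X : Set (Fin n → ℝ)} (hX : IsPermutationEnvironment X)
    (s : Fin n → Bool) : OfferRule X where
  offer i b :=
    if s i = true then Offer.posted 0 ⊤
    else Offer.combination (levelWeight (efoAlloc hX (masked s b)))
      fun j => Offer.posted 1 (winningBids s b i (sortDesc (masked s b) j) j)
  offer_update i b z := by
    split_ifs with hs
    · rfl
    · rw [masked_update hs, winningBids_update]
  feasible b := by
    classical
    set x := efoAlloc hX (masked s b) with hx
    obtain ⟨hxX, hxa, -⟩ := efoAlloc_spec hX (masked s b)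
    rw [← hx] at hxX hxa
    have hx0 := fun i => (hX.subset_cube x hxX i).1
    -- A bidder of rank r wins only at levels j ≥ r, so it gets at most the sum of the drops from r
    -- on, which telescopes to the entry of `x` at r. Ranks are distinct.
    refine hX.mem_of_injOn hxX (s := {i | s i = false})
      (f := fun i => if h : s i = false then ⟨rank s b i (b i), rank_lt s b h⟩ else i)
      ?_ ?_ ?_ ?_
    · intro i hi k hk h
      rw [Set.mem_ofPred_eq] at hi hk
      simp only [hi, hk, dif_pos, Fin.mk.injEq] at h
      exact rank_injOn s b hi hk h
    · exact fun i => Offer.alloc_nonneg _ _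
    · intro i hi
      have hi' : s i = true := by simpa using hi
      simp only [hi', if_true, Offer.posted_alloc]
      simp
    · intro i hi
      rw [Set.mem_ofPred_eq] at hi
      simp only [hi, dif_pos, Bool.false_eq_true, if_false, Offer.combination,
        Offer.posted_alloc, coe_levelWeight hxa hx0]
      refine le_trans ?_ (sum_Ici_sub_nextEntry x ⟨rank s b i (b i), rank_lt s b hi⟩).le
      rw [← Finset.filter_le_eq_Ici, Finset.sum_filter]
      refine Finset.sum_le_sum fun j _ => ?_
      have hq := sub_nonneg.mpr (nextEntry_le hxa hx0 j)
      by_cases hj : b i ∈ winningBids s b i (sortDesc (masked s b) j) j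
      · have : (⟨rank s b i (b i), rank_lt s b hi⟩ : Fin n) ≤ j := hj.2
        simp [hj, this]
      · rw [if_neg hj, mul_zero]
        split_ifs <;> simp [hq]

/-- If at every price the bidders outside the sample are at least as many as those in the sample,
then the sampling rule extracts the envy-free optimal revenue of the sample. -/
theorem EFO_masked_le_revenue {X : Set (Fin n → ℝ)} (hX : IsPermutationEnvironment X)
    (s : Fin n → Bool) (v : Fin n → ℝ≥0)
    (hbal : ∀ t, (Finset.univ.filter fun i => s i = true ∧ t ≤ v i).card
      ≤ (Finset.univ.filter fun i => s i = false ∧ t ≤ v i).card) :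
    EFO X (masked s v) ≤ (samplingRule hX s).revenue v := by
  classical
  obtain ⟨hxX, hxa, hxe⟩ := efoAlloc_spec hX (masked s v)
  set x := efoAlloc hX (masked s v) with hx
  have hx0 := fun i => (hX.subset_cube x hxX i).1
  set u := sortDesc (masked s v) with hu
  let o : Fin n → Fin n → Offer := fun i j => Offer.posted 1 (winningBids s v i (u j) j)
  have hrev : (samplingRule hX s).revenue v
      = ∑ j, (x j - nextEntry x j) *
          ∑ i ∈ Finset.univ.filter (fun i => s i = false), (o i j).pay (v i) := by
    simp only [Finset.mul_sum]
    rw [Finset.sum_comm, Finset.sum_filter]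
    refine Finset.sum_congr rfl fun i _ => ?_
    cases hs : s i
    · simp [samplingRule, hs, Offer.combination, ← hx, ← hu, coe_levelWeight hxa hx0, o]
    · simp [samplingRule, hs, Offer.posted_pay]
  rw [hrev, ← hxe, envyFreeRevenue_eq]
  refine Finset.sum_le_sum fun j _ => mul_le_mul_of_nonneg_left ?_
    (sub_nonneg.mpr (nextEntry_le hxa hx0 j))
  -- Unsampled bidders are masked by zeros, so the j + 1 entries at or above `u j` come from real
  -- sampled bidders only when `u j` is nonzero; a zero price earns nothing anyway.
  rcases eq_or_ne (u j) 0 with h0 | h0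
  · rw [h0]
    simpa using Finset.sum_nonneg fun i _ => (o i j).pay_nonneg (v i)
  · have hA : j.val + 1 ≤ (Finset.univ.filter fun i => s i = true ∧ u j ≤ v i).card := by
      refine ((le_sortDesc_iff (masked s v) (u j) j).mp le_rfl).trans
        (Finset.card_le_card fun i hi => ?_)
      have h' := (Finset.mem_filter.mp hi).2
      unfold masked at h'
      split_ifs at h' with h
      · exact Finset.mem_filter.mpr ⟨Finset.mem_univ i, h, h'⟩
      · exact absurd (le_antisymm h' zero_le) h0
    have hB := le_card_rank_le s v (u j) j (hA.trans (hbal (u j)))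
    calc ((j.val + 1 : ℕ) : ℝ) * u j
        ≤ ((Finset.univ.filter fun i =>
            s i = false ∧ u j ≤ v i ∧ rank s v i (v i) ≤ j.val).card : ℝ) * u j := by
          gcongr
      _ ≤ ∑ i ∈ Finset.univ.filter (fun i =>
            s i = false ∧ u j ≤ v i ∧ rank s v i (v i) ≤ j.val), (o i j).pay (v i) := by
          rw [← nsmul_eq_mul]
          refine Finset.card_nsmul_le_sum _ _ _ fun i hi => ?_
          simp only [Finset.mem_filter, Finset.mem_univ, true_and] at hi
          have := Offer.le_posted_pay (c := 1) (W := winningBids s v i (u j) j)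
            (mem_winningBids.mpr hi.2) (t := u j) fun y hy => hy.1
          simpa [o] using this
      _ ≤ _ := by
          refine Finset.sum_le_sum_of_subset_of_nonneg (fun i => ?_)
            fun i _ _ => (o i j).pay_nonneg _
          simp only [Finset.mem_filter, Finset.mem_univ, true_and]
          exact fun h => h.1

/-- The bidders in descending order of their values. -/
noncomputable def sortPerm (v : Fin n → ℝ≥0) : Equiv.Perm (Fin n) :=
  Tuple.sort fun j => OrderDual.toDual (v j)

theorem apply_sortPerm (v : Fin n → ℝ≥0) (k : Fin n) : v (sortPerm v k) = sortDesc v k := rfl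

theorem card_filter_eq_prefixCount (s : Fin n → Bool) (v : Fin n → ℝ≥0) (a : Bool) (t : ℝ≥0) :
    (Finset.univ.filter fun i => s i = a ∧ t ≤ v i).card
      = prefixCount a (s ∘ sortPerm v) (Finset.univ.filter fun i => t ≤ v i).card := by
  symm
  refine Finset.card_equiv (sortPerm v) fun k => ?_
  simp only [Finset.mem_filter, Finset.mem_univ, true_and, Function.comp_apply, apply_sortPerm]
  rw [le_sortDesc_iff, Nat.lt_iff_add_one_le, and_comm]

/-- Restrict each level of `x` to the sample: of the top j + 1 bidders keep the c_j sampled ones.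
This shrinks `x`, so it stays feasible, and the c_j-th highest sampled value is at least the (j +
1)-th highest value overall. -/
theorem le_EFO_masked {X : Set (Fin n → ℝ)} (hX : IsPermutationEnvironment X)
    (s : Fin n → Bool) (v : Fin n → ℝ≥0) {x : Fin n → ℝ} (hx : x ∈ X) (ha : Antitone x) :
    ∑ j, (x j - nextEntry x j) *
        ((prefixCount true (s ∘ sortPerm v) (j.val + 1) : ℝ) * sortDesc v j)
      ≤ EFO X (masked s v) := by
  have hx0 := fun i => (hX.subset_cube x hx i).1
  have hq := fun j => sub_nonneg.mpr (nextEntry_le ha hx0 j)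
  let c : Fin n → ℕ := fun j => prefixCount true (s ∘ sortPerm v) (j.val + 1)
  have hc : ∀ j, c j ≤ j.val + 1 := fun j => prefixCount_le _ _ _
  let y : Fin n → ℝ := fun k => ∑ j, (x j - nextEntry x j) * if k.val < c j then 1 else 0
  have hya : Antitone y := by
    intro k l hkl
    refine Finset.sum_le_sum fun j _ => mul_le_mul_of_nonneg_left ?_ (hq j)
    have : k.val ≤ l.val := hkl
    split_ifs
    · exact le_rfl
    · omega
    · exact zero_le_one
    · exact le_rfl
  have hyX : y ∈ X := by
    refine hX.downwardClosed x hx y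
      (fun k => Finset.sum_nonneg fun j _ => mul_nonneg (hq j) (by split_ifs <;> simp)) fun k => ?_
    rw [← sum_Ici_sub_nextEntry x k, ← Finset.filter_le_eq_Ici, Finset.sum_filter]
    refine Finset.sum_le_sum fun j _ => ?_
    by_cases hj : k ≤ j
    · rw [if_pos hj]
      refine mul_le_of_le_one_right (hq j) ?_
      split_ifs <;> simp
    · have : ¬ k.val < c j := by
        have := hc j
        rw [Fin.le_def] at hj
        omega
      simp [hj, this]
  have hnext : ∀ k, nextEntry y k
      = ∑ j, (x j - nextEntry x j) * if k.val + 1 < c j then 1 else 0 := by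
    intro k
    unfold nextEntry
    split_ifs with h
    · rfl
    · symm
      refine Finset.sum_eq_zero fun j _ => ?_
      have := hc j
      rw [if_neg (by omega), mul_zero]
  refine le_trans ?_ (hX.le_EFO hyX hya (masked s v))
  rw [envyFreeRevenue_eq]
  have hswap : ∑ k, (y k - nextEntry y k) * ((k.val + 1 : ℕ) * (sortDesc (masked s v) k : ℝ))
      = ∑ j, (x j - nextEntry x j) * ∑ k : Fin n,
        ((if k.val < c j then (1 : ℝ) else 0) - if k.val + 1 < c j then 1 else 0) *
          ((k.val + 1 : ℕ) * (sortDesc (masked s v) k : ℝ)) := by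
    simp only [Finset.mul_sum]
    rw [Finset.sum_comm]
    refine Finset.sum_congr rfl fun k _ => ?_
    rw [hnext, ← Finset.sum_sub_distrib, Finset.sum_mul]
    refine Finset.sum_congr rfl fun j _ => ?_
    ring
  rw [hswap]
  refine Finset.sum_le_sum fun j _ => mul_le_mul_of_nonneg_left ?_ (hq j)
  have hterm : ∀ k : Fin n, 0 ≤
      ((if k.val < c j then (1 : ℝ) else 0) - if k.val + 1 < c j then 1 else 0) *
        ((k.val + 1 : ℕ) * (sortDesc (masked s v) k : ℝ)) := by
    intro k
    refine mul_nonneg ?_ (by positivity)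
    split_ifs
    · simp
    · simp
    · omega
    · simp
  rcases Nat.eq_zero_or_pos (c j) with h0 | h0
  · have : prefixCount true (s ∘ sortPerm v) (j.val + 1) = 0 := h0
    rw [this]
    simpa using Finset.sum_nonneg fun k _ => hterm k
  · have hlt : c j - 1 < n := by
      have := hc j
      omega
    -- The difference of indicators is nonzero only at k = c_j - 1, the last bidder served at this
    -- level.
    refine le_trans ?_ (Finset.single_le_sum (fun k _ => hterm k)
      (Finset.mem_univ (⟨c j - 1, hlt⟩ : Fin n)))
    have h1 : c j - 1 < c j := by omega
    have h2 : ¬ c j - 1 + 1 < c j := by omega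
    simp only [h1, h2, if_true, if_false, sub_zero, one_mul]
    rw [Nat.sub_add_cancel h0]
    refine mul_le_mul_of_nonneg_left ?_ (Nat.cast_nonneg _)
    have : sortDesc v j ≤ sortDesc (masked s v) ⟨c j - 1, hlt⟩ := by
      rw [le_sortDesc_iff, Nat.sub_add_cancel h0]
      refine Finset.card_le_card_of_injOn (sortPerm v) (fun k hk => ?_)
        (sortPerm v).injective.injOn
      simp only [Finset.coe_filter, Finset.mem_univ, true_and, Function.comp_apply,
        Set.mem_ofPred_eq] at hk ⊢
      unfold masked
      rw [if_pos hk.2]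
      exact sortDesc_antitone v (a := k) (by rw [Fin.le_def]; omega)
    exact_mod_cast this

open Classical in
/-- Sampling every bidder with probability `1 / 4`. -/
theorem exists_sampling_rule {X : Set (Fin n → ℝ)} (hX : IsPermutationEnvironment X) :
    ∃ R : OfferRule X, ∀ v, ∀ x ∈ X, Antitone x →
      ∑ j, (x j - nextEntry x j) * (max 0 (((j.val + 1 : ℕ) : ℝ) / 6 - 1 / 3) * sortDesc v j)
        ≤ R.revenue v := by
  refine ⟨OfferRule.mix hX.convex sampleWeight (sum_sampleWeight n) (samplingRule hX),
    fun v x hx ha => ?_⟩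
  have hx0 := fun i => (hX.subset_cube x hx i).1
  have hq := fun j => sub_nonneg.mpr (nextEntry_le ha hx0 j)
  rw [OfferRule.revenue_mix]
  -- Independent identical coin tosses are exchangeable, so the walk may read the bidders in
  -- descending order of value.
  have hreindex : ∑ s : Fin n → Bool, (sampleWeight s : ℝ) * (samplingRule hX s).revenue v
      = ∑ s : Fin n → Bool, (sampleWeight s : ℝ) *
          (samplingRule hX (s ∘ (sortPerm v).symm)).revenue v := by
    symm
    refine Fintype.sum_equiv ((sortPerm v).arrowCongr (Equiv.refl Bool)) _ _ fun s => ?_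
    have h1 : (sortPerm v).arrowCongr (Equiv.refl Bool) s = s ∘ (sortPerm v).symm := rfl
    have h2 : sampleWeight (s ∘ (sortPerm v).symm) = sampleWeight s :=
      Equiv.prod_comp (sortPerm v).symm fun k => if s k = true then (1 / 4 : ℝ≥0) else 3 / 4
    rw [h1, h2]
  rw [hreindex]
  have hs : ∀ s : Fin n → Bool,
      (sampleWeight s : ℝ) * (if StaysPositive 1 s then
        ∑ j, (x j - nextEntry x j) * ((prefixCount true s (j.val + 1) : ℝ) * sortDesc v j) else 0)
      ≤ sampleWeight s * (samplingRule hX (s ∘ (sortPerm v).symm)).revenue v := by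
    intro s
    refine mul_le_mul_of_nonneg_left ?_ (sampleWeight s).2
    have hcomp : (s ∘ (sortPerm v).symm) ∘ sortPerm v = s := by
      funext k
      simp
    split_ifs with hpos
    · refine le_trans ?_ (EFO_masked_le_revenue hX _ v fun t => ?_)
      · have := le_EFO_masked hX (s ∘ (sortPerm v).symm) v hx ha
        rwa [hcomp] at this
      -- The bidders above a price form a prefix of the sorted order, and a walk started at 1 stays
      -- positive exactly when no prefix has more sampled than unsampled bidders.
      · rw [card_filter_eq_prefixCount, card_filter_eq_prefixCount, hcomp]
        have := hpos (Finset.univ.filter fun i => t ≤ v i).card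
        omega
    · exact OfferRule.revenue_nonneg _ _
  refine le_trans ?_ (Finset.sum_le_sum fun s _ => hs s)
  have hlin : ∑ s : Fin n → Bool, (sampleWeight s : ℝ) * (if StaysPositive 1 s then
        ∑ j, (x j - nextEntry x j) * ((prefixCount true s (j.val + 1) : ℝ) * sortDesc v j) else 0)
      = ∑ j, (x j - nextEntry x j) * ((∑ s : Fin n → Bool, (sampleWeight s : ℝ) *
          if StaysPositive 1 s then (prefixCount true s (j.val + 1) : ℝ) else 0)
            * sortDesc v j) := by
    simp only [Finset.sum_mul, Finset.mul_sum]
    rw [Finset.sum_comm]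
    refine Finset.sum_congr rfl fun s _ => ?_
    split_ifs
    · rw [Finset.mul_sum]
      refine Finset.sum_congr rfl fun j _ => ?_
      ring
    · simp
  rw [hlin]
  refine Finset.sum_le_sum fun j _ => mul_le_mul_of_nonneg_left
    (mul_le_mul_of_nonneg_right (max_le ?_ ?_) (sortDesc v j).2) (hq j)
  · refine Finset.sum_nonneg fun s _ => mul_nonneg (sampleWeight s).2 ?_
    split_ifs <;> simp
  · refine le_trans (le_of_eq ?_) (le_sum_prefixCount n 1 (j.val + 1) j.isLt)
    norm_num
    ring

/-! ### The 8-competitive auction without predictions. -/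

/-- The single-bidder Vickrey auction. -/
theorem exists_vickrey_rule (hn : 2 ≤ n) {X : Set (Fin n → ℝ)} {c : ℝ≥0}
    (hc : ∀ (i : Fin n) (y : Fin n → ℝ), (∀ k, 0 ≤ y k) → (∀ k, k ≠ i → y k = 0) → y i ≤ c →
      y ∈ X) :
    ∃ R : OfferRule X, ∀ v, (c : ℝ) * sortDesc v ⟨1, hn⟩ ≤ R.revenue v := by
  classical
  have hwin : ∀ b : Fin n → ℝ≥0, ∃ i, rank (fun _ => false) b i (b i) = 0 := by
    intro b
    have := le_card_rank_le (fun _ => false) b 0 0 (by simp; omega)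
    obtain ⟨i, hi⟩ := Finset.card_pos.mp this
    exact ⟨i, by simpa using hi⟩
  refine ⟨{ offer := fun i b => Offer.posted c (winningBids (fun _ => false) b i 0 0),
            offer_update := fun i b z => by rw [winningBids_update],
            feasible := fun b => ?_ }, fun v => ?_⟩
  · obtain ⟨i, hi⟩ := hwin b
    refine hc i _ (fun k => Offer.alloc_nonneg _ _) (fun k hk => ?_) ?_
    · rw [Offer.posted_alloc, if_neg]
      rintro ⟨-, h⟩
      exact hk (rank_injOn (fun _ => false) b (by simp) (by simp)
        ((Nat.le_zero.mp h).trans hi.symm))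
    · simp only [Offer.posted_alloc]
      split_ifs <;> simp
  · obtain ⟨i, hi⟩ := hwin v
    refine le_trans ?_ (Finset.single_le_sum (fun k _ => Offer.pay_nonneg _ _)
      (Finset.mem_univ i))
    refine Offer.le_posted_pay (mem_winningBids.mpr ⟨zero_le, hi.le⟩) fun y hy => ?_
    -- A bid below the second-highest value would be outranked by this `k`, so the winning threshold
    -- is at least that value.
    obtain ⟨k, hki, hk⟩ := exists_ne_second_le hn v i
    by_contra hlt
    have h0 := Nat.le_zero.mp hy.2
    unfold rank at h0
    rw [Finset.card_eq_zero] at h0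
    have : k ∈ (∅ : Finset (Fin n)) := by
      rw [← h0]
      simp [hki, (not_le.mp hlt).trans_le hk]
    simp at this

/-- An `8`-competitive auction without predictions. -/
theorem exists_competitive_rule (hn : 2 ≤ n) {X : Set (Fin n → ℝ)}
    (hX : IsPermutationEnvironment X) :
    ∃ R : OfferRule X, ∀ v, EFO2 hn X v ≤ 8 * R.revenue v := by
  obtain ⟨c, hcmax, hc⟩ := hX.exists_max_service (by omega)
  obtain ⟨V, hV⟩ := exists_vickrey_rule hn hc
  obtain ⟨S, hS⟩ := exists_sampling_rule hX
  refine ⟨OfferRule.mix hX.convex ![1 / 4, 3 / 4] ?_ ![V, S], fun v => ?_⟩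
  · rw [Fin.sum_univ_two, ← NNReal.coe_inj]
    norm_num
  rw [OfferRule.revenue_mix, Fin.sum_univ_two]
  obtain ⟨x, hx, ha, he⟩ := hX.exists_EFO (replaceTop hn v)
  have hx0 := fun i => (hX.subset_cube x hx i).1
  have hq := fun j => sub_nonneg.mpr (nextEntry_le ha hx0 j)
  have hv := hV v
  have hs := hS v x hx ha
  have hmin : ∀ j, (replaceTop hn v j : ℝ) ≤ sortDesc v j ∧
      (replaceTop hn v j : ℝ) ≤ sortDesc v ⟨1, hn⟩ := by
    intro j
    rw [replaceTop_eq_min]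
    exact ⟨by exact_mod_cast min_le_left _ _, by exact_mod_cast min_le_right _ _⟩
  have h1 : ∑ j, (x j - nextEntry x j) * (replaceTop hn v j : ℝ) ≤ V.revenue v := by
    refine le_trans ?_ hv
    refine (Finset.sum_le_sum fun j _ => mul_le_mul_of_nonneg_left (hmin j).2 (hq j)).trans ?_
    rw [← Finset.sum_mul]
    refine mul_le_mul_of_nonneg_right ?_ (sortDesc v ⟨1, hn⟩).2
    have hsum := sum_Ici_sub_nextEntry x ⟨0, by omega⟩
    have huniv : Finset.Ici (⟨0, by omega⟩ : Fin n) = Finset.univ := by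
      ext j
      simp [Fin.le_def]
    rw [huniv] at hsum
    rw [hsum]
    exact hcmax x hx _
  unfold EFO2
  rw [← he, sortDesc_of_antitone (replaceTop_antitone hn v), envyFreeRevenue_eq]
  -- This is k ≤ 2 + 6 max(0, k/6 - 1/3) on each level. The weights 1/4 and 3/4 are chosen so that 8
  -- times the mixed revenue is 2 times the Vickrey revenue plus 6 times the sampling revenue.
  have h2 : ∑ j, (x j - nextEntry x j) * ((j.val + 1 : ℕ) * (replaceTop hn v j : ℝ))
      ≤ 2 * ∑ j, (x j - nextEntry x j) * (replaceTop hn v j : ℝ)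
        + 6 * ∑ j, (x j - nextEntry x j) *
          (max 0 (((j.val + 1 : ℕ) : ℝ) / 6 - 1 / 3) * sortDesc v j) := by
    rw [Finset.mul_sum, Finset.mul_sum, ← Finset.sum_add_distrib]
    refine Finset.sum_le_sum fun j _ => ?_
    have hm0 := le_max_left 0 (((j.val + 1 : ℕ) : ℝ) / 6 - 1 / 3)
    have hm1 := le_max_right 0 (((j.val + 1 : ℕ) : ℝ) / 6 - 1 / 3)
    set g := max 0 (((j.val + 1 : ℕ) : ℝ) / 6 - 1 / 3)
    have hr : (0 : ℝ) ≤ replaceTop hn v j := (replaceTop hn v j).2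
    have h3 := mul_le_mul_of_nonneg_left (hmin j).1 hm0
    have h4 : ((j.val + 1 : ℕ) : ℝ) * (replaceTop hn v j : ℝ)
        ≤ 2 * replaceTop hn v j + 6 * (g * sortDesc v j) := by nlinarith
    have h5 := mul_le_mul_of_nonneg_left h4 (hq j)
    linarith
  simp only [Matrix.cons_val_zero, Matrix.cons_val_one]
  have e1 : ((1 / 4 : ℝ≥0) : ℝ) = 1 / 4 := by norm_num
  have e2 : ((3 / 4 : ℝ≥0) : ℝ) = 3 / 4 := by norm_num
  rw [e1, e2]
  linarith

/-! ### Rules that use the prediction. -/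

open Classical in
theorem Offer.posted_Ici_alloc (c t z : ℝ≥0) :
    (Offer.posted c (UpperSet.Ici t)).alloc z = if t ≤ z then (c : ℝ) else 0 := by
  rw [Offer.posted_alloc]
  rfl

open Classical in
theorem Offer.posted_Ici_pay (c t z : ℝ≥0) :
    (Offer.posted c (UpperSet.Ici t)).pay z = if t ≤ z then (c : ℝ) * t else 0 := by
  rw [Offer.posted_pay, UpperSet.coe_Ici, csInf_Ici]
  rfl

/-- A welfare-maximizing feasible allocation. -/
noncomputable def optAlloc {X : Set (Fin n → ℝ)} (hX : IsPermutationEnvironment X)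
    (v : Fin n → ℝ≥0) : Fin n → ℝ :=
  Classical.choose (hX.exists_OPT v)

theorem optAlloc_mem {X : Set (Fin n → ℝ)} (hX : IsPermutationEnvironment X)
    (v : Fin n → ℝ≥0) : optAlloc hX v ∈ X :=
  (Classical.choose_spec (hX.exists_OPT v)).1

theorem sum_optAlloc {X : Set (Fin n → ℝ)} (hX : IsPermutationEnvironment X)
    (v : Fin n → ℝ≥0) : ∑ i, optAlloc hX v i * (v i : ℝ) = OPT X v :=
  (Classical.choose_spec (hX.exists_OPT v)).2

theorem coe_toNNReal_optAlloc {X : Set (Fin n → ℝ)} (hX : IsPermutationEnvironment X)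
    (v : Fin n → ℝ≥0) (i : Fin n) : ((optAlloc hX v i).toNNReal : ℝ) = optAlloc hX v i :=
  Real.coe_toNNReal _ (hX.subset_cube _ (optAlloc_mem hX v) i).1

theorem optAlloc_nonneg {X : Set (Fin n → ℝ)} (hX : IsPermutationEnvironment X)
    (v : Fin n → ℝ≥0) (i : Fin n) : 0 ≤ optAlloc hX v i :=
  (hX.subset_cube _ (optAlloc_mem hX v) i).1

/-- The bids of all bidders but `i` are as predicted. -/
def OthersAgree (p : Fin n → ℝ≥0) (i : Fin n) (b : Fin n → ℝ≥0) : Prop :=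
  ∀ k, k ≠ i → b k = p k

/-- Among the bidders other than `i`, exactly one deviates from the prediction, upwards. -/
def OneOtherUp (p : Fin n → ℝ≥0) (i : Fin n) (b : Fin n → ℝ≥0) : Prop :=
  ∃ j, j ≠ i ∧ p j < b j ∧ ∀ k, k ≠ i → k ≠ j → b k = p k

theorem othersAgree_update (p : Fin n → ℝ≥0) (i : Fin n) (b : Fin n → ℝ≥0) (z : ℝ≥0) :
    OthersAgree p i (Function.update b i z) ↔ OthersAgree p i b :=
  forall₂_congr fun k hk => by rw [Function.update_of_ne hk]

theorem oneOtherUp_update (p : Fin n → ℝ≥0) (i : Fin n) (b : Fin n → ℝ≥0) (z : ℝ≥0) :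
    OneOtherUp p i (Function.update b i z) ↔ OneOtherUp p i b := by
  refine exists_congr fun j => and_congr_right fun hj => ?_
  rw [Function.update_of_ne hj]
  refine and_congr_right fun _ => forall₂_congr fun k hk => ?_
  rw [Function.update_of_ne hk]

open Classical in
/-- The rule `R`, overridden next to the prediction `p`: whoever sees all others bid as predicted
is offered the optimal amount of service at the predicted value. -/
noncomputable def overrideRule {X : Set (Fin n → ℝ)} (hX : IsPermutationEnvironment X)
    (p : Fin n → ℝ≥0) (R : OfferRule X) : OfferRule X where
  offer i b :=
    if OthersAgree p i b then Offer.posted (optAlloc hX p i).toNNReal (UpperSet.Ici (p i))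
    else if OneOtherUp p i b then (R.offer i b).withReserve (p i)
    else R.offer i b
  offer_update i b z := by
    simp only [othersAgree_update, oneOtherUp_update, R.offer_update]
  feasible b := by
    -- In the first case either the bids equal p, or `i` alone is up and every other bidder sits
    -- exactly at its strict reserve and gets nothing; both stay below the optimal allocation of p.
    -- Otherwise whoever sees agreement rejects the price, and nobody gets more than under `R`.
    by_cases h : ∃ i, OthersAgree p i b ∧ p i ≤ b i
    · obtain ⟨i, hi, hpi⟩ := h
      refine hX.downwardClosed _ (optAlloc_mem hX p) _ (fun k => Offer.alloc_nonneg _ _)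
        fun k => ?_
      have h0 := optAlloc_nonneg hX p k
      by_cases hk : OthersAgree p k b
      · simp only [hk, if_true, Offer.posted_Ici_alloc, coe_toNNReal_optAlloc]
        split_ifs
        · exact le_rfl
        · exact h0
      · have hki : k ≠ i := fun h => hk (h ▸ hi)
        have hne : b i ≠ p i := by
          intro he
          refine hk fun l _ => ?_
          by_cases hl : l = i
          · rw [hl, he]
          · exact hi l hl
        have hup : OneOtherUp p k b :=
          ⟨i, hki.symm, lt_of_le_of_ne hpi hne.symm, fun l _ hl => hi l hl⟩
        simp only [hk, hup, if_true, if_false, Offer.withReserve, hi k hki, lt_irrefl]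
        exact h0
    · refine hX.downwardClosed _ (R.feasible b) _ (fun k => Offer.alloc_nonneg _ _) fun k => ?_
      have h0 := (R.offer k b).alloc_nonneg (b k)
      by_cases hk : OthersAgree p k b
      · have : ¬ p k ≤ b k := fun hp => h ⟨k, hk, hp⟩
        simp only [hk, if_true, Offer.posted_Ici_alloc, this, if_false]
        exact h0
      · by_cases hu : OneOtherUp p k b
        · simp only [hk, hu, if_true, if_false, Offer.withReserve]
          split_ifs
          · exact le_rfl
          · exact h0
        · simp only [hk, hu, if_false]
          exact le_rfl

/-- Only reserves are imposed here, each of them is cleared, and clearing one adds a nonnegative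
fee. -/
theorem revenue_le_overrideRule {X : Set (Fin n → ℝ)} (hX : IsPermutationEnvironment X)
    (p : Fin n → ℝ≥0) (R : OfferRule X) (v : Fin n → ℝ≥0) (h1 : ∀ i, ¬ OthersAgree p i v)
    (h2 : ∀ i, OneOtherUp p i v → p i < v i) :
    R.revenue v ≤ (overrideRule hX p R).revenue v := by
  refine Finset.sum_le_sum fun i _ => ?_
  by_cases hi : OneOtherUp p i v
  · simp only [overrideRule, h1 i, if_false, hi, if_true, Offer.withReserve, h2 i hi]
    have := (R.offer i v).pay_le (p i)
    unfold Offer.util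
    linarith
  · simp only [overrideRule, h1 i, if_false, hi]
    exact le_rfl

theorem overrideRule_revenue_self {X : Set (Fin n → ℝ)} (hX : IsPermutationEnvironment X)
    (p : Fin n → ℝ≥0) (R : OfferRule X) : (overrideRule hX p R).revenue p = OPT X p := by
  rw [← sum_optAlloc hX]
  refine Finset.sum_congr rfl fun i _ => ?_
  have : OthersAgree p i p := fun _ _ => rfl
  simp only [overrideRule, this, if_true, Offer.posted_Ici_pay, le_refl, coe_toNNReal_optAlloc]

/-- The prediction `p`, set to zero where the bid is below it. -/
noncomputable def trimmed (p b : Fin n → ℝ≥0) : Fin n → ℝ≥0 :=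
  fun k => if b k < p k then 0 else p k

theorem trimmed_self (p : Fin n → ℝ≥0) : trimmed p p = p := by
  funext k
  simp [trimmed]

theorem trimmed_update {p b : Fin n → ℝ≥0} {i : Fin n} (h : p i ≤ b i) :
    trimmed p (Function.update b i (p i)) = trimmed p b := by
  funext l
  by_cases hl : l = i
  · subst hl
    simp [trimmed, not_lt.mpr h]
  · simp [trimmed, Function.update_of_ne hl]

/-- The predicted values are posted, with the amounts of an optimal allocation among the bidders
that bid at least their predicted values. -/
noncomputable def postedPredictionRule {X : Set (Fin n → ℝ)} (hX : IsPermutationEnvironment X)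
    (p : Fin n → ℝ≥0) : OfferRule X where
  -- Resetting the own bid to the prediction makes the offer independent of it; for bidders who
  -- accept, the trimmed vector is unchanged, so all accepted amounts come from one allocation.
  offer i b := Offer.posted (optAlloc hX (trimmed p (Function.update b i (p i))) i).toNNReal
    (UpperSet.Ici (p i))
  offer_update i b z := by rw [Function.update_idem]
  feasible b := by
    refine hX.downwardClosed _ (optAlloc_mem hX (trimmed p b)) _
      (fun k => Offer.alloc_nonneg _ _) fun k => ?_
    rw [Offer.posted_Ici_alloc]
    split_ifs with h
    · rw [coe_toNNReal_optAlloc, trimmed_update h]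
    · exact optAlloc_nonneg hX _ k

theorem postedPredictionRule_revenue {X : Set (Fin n → ℝ)} (hX : IsPermutationEnvironment X)
    (p v : Fin n → ℝ≥0) : (postedPredictionRule hX p).revenue v = OPT X (trimmed p v) := by
  rw [← sum_optAlloc hX]
  refine Finset.sum_congr rfl fun i _ => ?_
  simp only [postedPredictionRule, Offer.posted_Ici_pay]
  split_ifs with h
  · rw [coe_toNNReal_optAlloc, trimmed_update h]
    simp [trimmed, not_lt.mpr h]
  · simp [trimmed, not_le.mp h]

/-- The highest bid of the competitors of `i`. -/
noncomputable def maxOther (i : Fin n) (b : Fin n → ℝ≥0) : ℝ≥0 :=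
  (Finset.univ.erase i).sup b

theorem le_maxOther {i k : Fin n} (h : k ≠ i) (b : Fin n → ℝ≥0) : b k ≤ maxOther i b :=
  Finset.le_sup (f := b) (by simp [h])

theorem maxOther_update (i : Fin n) (b : Fin n → ℝ≥0) (z : ℝ≥0) :
    maxOther i (Function.update b i z) = maxOther i b := by
  refine Finset.sup_congr rfl fun k hk => ?_
  rw [Function.update_of_ne (Finset.ne_of_mem_erase hk)]

/-- A competitor of `i` bids below the prediction. -/
def SeesDown (p : Fin n → ℝ≥0) (i : Fin n) (b : Fin n → ℝ≥0) : Prop :=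
  ∃ k, k ≠ i ∧ b k < p k

theorem seesDown_update (p : Fin n → ℝ≥0) (i : Fin n) (b : Fin n → ℝ≥0) (z : ℝ≥0) :
    SeesDown p i (Function.update b i z) ↔ SeesDown p i b :=
  exists_congr fun k => and_congr_right fun hk => by rw [Function.update_of_ne hk]

open Classical in
/-- The price for a bidder whose competitors all bid at least the prediction. -/
noncomputable def cappedPrice (p : Fin n → ℝ≥0) (i : Fin n) (b : Fin n → ℝ≥0) : ℝ≥0 :=
  if OthersAgree p i b then p i else min (p i) (maxOther i b)

open Classical in
/-- A bidder that sees a competitor below the prediction has to outbid all others; the other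
bidders are offered the predicted optimal amount, at a price of at most the highest other bid. -/
noncomputable def outbidRule {X : Set (Fin n → ℝ)} (hX : IsPermutationEnvironment X) {c : ℝ≥0}
    (hmax : ∀ x ∈ X, ∀ i, x i ≤ c)
    (hc : ∀ (i : Fin n) (y : Fin n → ℝ), (∀ k, 0 ≤ y k) → (∀ k, k ≠ i → y k = 0) → y i ≤ c →
      y ∈ X) (p : Fin n → ℝ≥0) : OfferRule X where
  offer i b :=
    if SeesDown p i b then Offer.posted c (UpperSet.Ioi (maxOther i b))
    else Offer.posted (optAlloc hX p i).toNNReal (UpperSet.Ici (cappedPrice p i b))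
  offer_update i b z := by
    simp only [seesDown_update, cappedPrice, othersAgree_update, maxOther_update]
  feasible b := by
    set y : Fin n → ℝ := fun i => (if SeesDown p i b then
      Offer.posted c (UpperSet.Ioi (maxOther i b)) else Offer.posted (optAlloc hX p i).toNNReal
        (UpperSet.Ici (cappedPrice p i b))).alloc (b i) with hy
    have hy0 : ∀ k, 0 ≤ y k := fun k => Offer.alloc_nonneg _ _
    have hdown : ∀ i, SeesDown p i b → y i ≠ 0 → ∀ k, k ≠ i → b k < b i := by
      intro i hi hne k hk
      simp only [hy, hi, if_true, Offer.posted_alloc] at hne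
      have : maxOther i b < b i := by
        by_contra h
        exact hne (if_neg h)
      exact (le_maxOther hk b).trans_lt this
    have hno : ∀ i, ¬ SeesDown p i b → y i ≠ 0 → cappedPrice p i b ≤ b i := by
      intro i hi hne
      simp only [hy, hi, if_false, Offer.posted_Ici_alloc] at hne
      by_contra h
      exact hne (if_neg h)
    -- Once somebody is below prediction at most one bidder is served. If `l` is the only such
    -- bidder, it alone sees no drop and must at least match the highest other bid; everyone else
    -- must strictly exceed all others, so ties cause no conflict.
    by_cases h : ∃ l, b l < p l
    · obtain ⟨l, hl⟩ := h
      have hmixed : ∀ i k, k ≠ i → ¬ SeesDown p i b → SeesDown p k b → y i ≠ 0 → y k ≠ 0 →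
          False := by
        intro i k hki hi hk hyi hyk
        have hli : l = i := by
          by_contra hli
          exact hi ⟨l, hli, hl⟩
        subst hli
        have h1 := hno l hi hyi
        have h2 := hdown k hk hyk l hki.symm
        unfold cappedPrice at h1
        split_ifs at h1
        · exact absurd hl (not_lt.mpr h1)
        · rcases min_le_iff.mp h1 with h1 | h1
          · exact absurd hl (not_lt.mpr h1)
          · exact absurd h2 (not_lt.mpr ((le_maxOther hki b).trans h1))
      have hunique : ∀ i k, k ≠ i → y i ≠ 0 → y k = 0 := by
        intro i k hki hyi
        by_contra hyk
        by_cases hi : SeesDown p i b <;> by_cases hk : SeesDown p k b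
        · exact lt_asymm (hdown i hi hyi k hki) (hdown k hk hyk i hki.symm)
        · exact hmixed k i hki.symm hk hi hyk hyi
        · exact hmixed i k hki hi hk hyi hyk
        · have h1 : l = i := by
            by_contra hli
            exact hi ⟨l, hli, hl⟩
          have h2 : l = k := by
            by_contra hlk
            exact hk ⟨l, hlk, hl⟩
          exact hki (h2.symm.trans h1)
      by_cases hex : ∃ i, y i ≠ 0
      · obtain ⟨i, hi⟩ := hex
        refine hc i y hy0 (fun k hk => hunique i k hk hi) ?_
        simp only [hy]
        split_ifs
        · rw [Offer.posted_alloc]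
          split_ifs <;> simp
        · rw [Offer.posted_Ici_alloc]
          split_ifs
          · rw [coe_toNNReal_optAlloc]
            exact hmax _ (optAlloc_mem hX p) i
          · exact c.2
      · have : y = fun _ => 0 := by
          funext k
          by_contra hk
          exact hex ⟨k, hk⟩
        rw [this]
        exact hX.zero_mem
    · refine hX.downwardClosed _ (optAlloc_mem hX p) y hy0 fun k => ?_
      have hk : ¬ SeesDown p k b := fun ⟨l, _, hl⟩ => h ⟨l, hl⟩
      simp only [hy, hk, if_false, Offer.posted_Ici_alloc]
      split_ifs
      · rw [coe_toNNReal_optAlloc]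
      · exact optAlloc_nonneg hX p k

theorem outbidRule_revenue_self {X : Set (Fin n → ℝ)} (hX : IsPermutationEnvironment X) {c : ℝ≥0}
    (hmax : ∀ x ∈ X, ∀ i, x i ≤ c)
    (hc : ∀ (i : Fin n) (y : Fin n → ℝ), (∀ k, 0 ≤ y k) → (∀ k, k ≠ i → y k = 0) → y i ≤ c →
      y ∈ X)
    (p : Fin n → ℝ≥0) :
    (outbidRule hX hmax hc p).revenue p = OPT X p := by
  rw [← sum_optAlloc hX]
  refine Finset.sum_congr rfl fun i _ => ?_
  have h1 : OthersAgree p i p := fun _ _ => rfl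
  have h2 : ¬ SeesDown p i p := fun ⟨k, _, hk⟩ => lt_irrefl _ hk
  simp only [outbidRule, h2, if_false, cappedPrice, h1, if_true, Offer.posted_Ici_pay, le_refl,
    coe_toNNReal_optAlloc]

/-! ### Robustness estimates near the prediction. -/

theorem mul_le_OPT {X : Set (Fin n → ℝ)} (hX : IsPermutationEnvironment X) {c : ℝ≥0}
    (hc : ∀ (i : Fin n) (y : Fin n → ℝ), (∀ k, 0 ≤ y k) → (∀ k, k ≠ i → y k = 0) → y i ≤ c →
      y ∈ X)
    (q : Fin n → ℝ≥0) (k : Fin n) : (c : ℝ) * q k ≤ OPT X q := by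
  have h : (fun l => if l = k then (c : ℝ) else 0) ∈ X := by
    refine hc k _ (fun l => ?_) (fun l hl => if_neg hl) (by simp)
    split_ifs
    · exact c.2
    · exact le_rfl
  have := hX.le_OPT h q
  simpa using this

/-- After capping at the second-highest value s, each coordinate in `D` contributes at most c s, and
the others are dominated by `q`. -/
theorem EFO2_le_of_le {X : Set (Fin n → ℝ)} (hX : IsPermutationEnvironment X) {c : ℝ≥0}
    (hmax : ∀ x ∈ X, ∀ i, x i ≤ c) (hn : 2 ≤ n) (v q : Fin n → ℝ≥0) (D : Finset (Fin n))
    (hq : ∀ l ∉ D, v l ≤ q l) :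
    EFO2 hn X v ≤ OPT X q + D.card * (c * sortDesc v ⟨1, hn⟩) := by
  refine (EFO2_le_OPT_min hn hX v).trans ?_
  obtain ⟨z, hz, he⟩ := hX.exists_OPT fun i => min (v i) (sortDesc v ⟨1, hn⟩)
  rw [← he]
  have hD : (D.card : ℝ) * (c * sortDesc v ⟨1, hn⟩)
      = ∑ l, if l ∈ D then (c : ℝ) * sortDesc v ⟨1, hn⟩ else 0 := by
    simp
  refine le_trans ?_ (add_le_add_left (hX.le_OPT hz q) _)
  rw [hD, ← Finset.sum_add_distrib]
  refine Finset.sum_le_sum fun l _ => ?_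
  have hz0 := (hX.subset_cube z hz l).1
  by_cases hl : l ∈ D
  · rw [if_pos hl]
    have h1 : ((min (v l) (sortDesc v ⟨1, hn⟩) : ℝ≥0) : ℝ) ≤ sortDesc v ⟨1, hn⟩ := by
      exact_mod_cast min_le_right _ _
    have h2 := mul_le_mul (hmax z hz l) h1 (NNReal.coe_nonneg _) c.2
    have h3 := mul_nonneg hz0 (q l).2
    simp only [NNReal.val_eq_coe] at h3
    linarith
  · rw [if_neg hl, add_zero]
    refine mul_le_mul_of_nonneg_left ?_ hz0
    exact_mod_cast (min_le_left _ _).trans (hq l hl)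

/-- Unless the bound is trivial, every bidder other than `i` and `j` is below s, as one alone would
give C ≥ c s. So `i` and `j` hold the two highest values, and the higher of them buys. -/
theorem le_outbidRule_revenue {X : Set (Fin n → ℝ)} (hX : IsPermutationEnvironment X) {c : ℝ≥0}
    (hmax : ∀ x ∈ X, ∀ i, x i ≤ c)
    (hc : ∀ (i : Fin n) (y : Fin n → ℝ), (∀ k, 0 ≤ y k) → (∀ k, k ≠ i → y k = 0) → y i ≤ c →
      y ∈ X)
    (hn : 2 ≤ n) (p v : Fin n → ℝ≥0) {i j : Fin n} (hij : i ≠ j)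
    (hi : p i < v i) (hj : v j < p j) (hk : ∀ k, k ≠ i → k ≠ j → v k = p k) :
    (c : ℝ) * sortDesc v ⟨1, hn⟩ - OPT X (trimmed p v) ≤ (outbidRule hX hmax hc p).revenue v := by
  classical
  have hrev0 := (outbidRule hX hmax hc p).revenue_nonneg v
  set s := sortDesc v ⟨1, hn⟩ with hs
  set C := OPT X (trimmed p v) with hC
  by_cases hsmall : (c : ℝ) * s ≤ C
  · linarith
  have hk_lt : ∀ k, k ≠ i → k ≠ j → v k < s := by
    intro k hki hkj
    by_contra hle
    refine hsmall (le_trans ?_ (mul_le_OPT hX hc (trimmed p v) k))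
    refine mul_le_mul_of_nonneg_left ?_ c.2
    have : trimmed p v k = v k := by
      simp [trimmed, hk k hki hkj]
    rw [this]
    exact_mod_cast not_lt.mp hle
  have hsi : s ≤ v i := by
    obtain ⟨k, hkj, hle⟩ := exists_ne_second_le hn v j
    by_cases hki : k = i
    · exact hki ▸ hle
    · exact absurd (hk_lt k hki hkj) (not_lt.mpr hle)
  have hsj : s ≤ v j := by
    obtain ⟨k, hki, hle⟩ := exists_ne_second_le hn v i
    by_cases hkj : k = j
    · exact hkj ▸ hle
    · exact absurd (hk_lt k hki hkj) (not_lt.mpr hle)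
  have hsingle : ∀ l, ((outbidRule hX hmax hc p).offer l v).pay (v l)
      ≤ (outbidRule hX hmax hc p).revenue v := fun l =>
    Finset.single_le_sum (f := fun l => ((outbidRule hX hmax hc p).offer l v).pay (v l))
      (fun k _ => Offer.pay_nonneg _ _) (Finset.mem_univ l)
  have hC0 : 0 ≤ C := (mul_nonneg c.2 (trimmed p v i).2).trans (mul_le_OPT hX hc _ i)
  by_cases hle : v i ≤ v j
  · have h1 : ¬ SeesDown p j v := by
      rintro ⟨k, hkj, hlt⟩
      by_cases hki : k = i
      · exact lt_asymm hi (hki ▸ hlt)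
      · exact hlt.ne (hk k hki hkj)
    have h2 : ¬ OthersAgree p j v := fun h => hi.ne' (h i hij)
    have h3 : maxOther j v ≤ v j := by
      refine Finset.sup_le fun k hk' => ?_
      by_cases hki : k = i
      · exact hki ▸ hle
      · exact (hk_lt k hki (Finset.ne_of_mem_erase hk')).le.trans hsj
    have h4 : v i ≤ cappedPrice p j v := by
      rw [cappedPrice, if_neg h2]
      exact le_min (hle.trans hj.le) (le_maxOther hij v)
    have h5 : cappedPrice p j v ≤ v j := by
      rw [cappedPrice, if_neg h2]
      exact (min_le_right _ _).trans h3
    have hpay : optAlloc hX p j * v i ≤ (outbidRule hX hmax hc p).revenue v := by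
      refine le_trans ?_ (hsingle j)
      simp only [outbidRule, h1, if_false, Offer.posted_Ici_pay, h5, if_true,
        coe_toNNReal_optAlloc]
      exact mul_le_mul_of_nonneg_left (by exact_mod_cast h4) (optAlloc_nonneg hX p j)
    -- Trimming removes only bidder `j`. With c p_j ≤ OPT(p) this gives (c - x_j) p_j ≤ C, hence (c
    -- - x_j) v_i ≤ C, so the payment x_j v_i is at least c v_i - C.
    have hopt : OPT X p ≤ C + optAlloc hX p j * p j := by
      rw [← sum_optAlloc hX p]
      refine le_trans ?_ (add_le_add_left (hX.le_OPT (optAlloc_mem hX p) (trimmed p v)) _)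
      have : optAlloc hX p j * (p j : ℝ)
          = ∑ l, if l = j then optAlloc hX p j * (p j : ℝ) else 0 := by simp
      rw [this, ← Finset.sum_add_distrib]
      refine Finset.sum_le_sum fun l _ => ?_
      by_cases hl : l = j
      · subst hl
        simp [trimmed, hj]
      · have : ¬ v l < p l := by
          by_cases hli : l = i
          · subst hli
            exact not_lt.mpr hi.le
          · exact (hk l hli hl).not_lt
        simp [trimmed, hl, this]
    have hcp := mul_le_OPT hX hc p j
    have hxc := hmax _ (optAlloc_mem hX p) j
    have hvp : (v i : ℝ) ≤ p j := by exact_mod_cast hle.trans hj.le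
    have h6 : ((c : ℝ) - optAlloc hX p j) * v i ≤ (c - optAlloc hX p j) * p j :=
      mul_le_mul_of_nonneg_left hvp (sub_nonneg.mpr hxc)
    have h7 : (c : ℝ) * s ≤ c * v i := mul_le_mul_of_nonneg_left (by exact_mod_cast hsi) c.2
    linarith
  -- Here `i` is strictly highest and buys the amount c at a price of at least v_j ≥ s.
  · have h1 : SeesDown p i v := ⟨j, hij.symm, hj⟩
    have h2 : maxOther i v < v i := by
      rw [maxOther, Finset.sup_lt_iff (bot_le.trans_lt hi)]
      intro k hk'
      by_cases hkj : k = j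
      · exact hkj ▸ not_le.mp hle
      · exact (hk_lt k (Finset.ne_of_mem_erase hk') hkj).trans_le hsi
    have hpay : (c : ℝ) * s ≤ (outbidRule hX hmax hc p).revenue v := by
      refine le_trans ?_ (hsingle i)
      simp only [outbidRule, h1, if_true]
      exact Offer.le_posted_pay h2 fun y hy =>
        hsj.trans ((le_maxOther hij.symm v).trans (le_of_lt hy))
    linarith

/-- For every prediction `p` there is an offer rule that extracts the optimal revenue if the
prediction is correct, and is `13.5`-competitive in any case. -/
theorem exists_prediction_rule (hn : 2 ≤ n) {X : Set (Fin n → ℝ)}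
    (hX : IsPermutationEnvironment X) (p : Fin n → ℝ≥0) :
    ∃ R : OfferRule X, R.revenue p = OPT X p ∧ ∀ v, 2 * EFO2 hn X v ≤ 27 * R.revenue v := by
  obtain ⟨c, hmax, hc⟩ := hX.exists_max_service (by omega)
  obtain ⟨R₀, hR₀⟩ := exists_competitive_rule hn hX
  let M := overrideRule hX p R₀
  let P := postedPredictionRule hX p
  let Q := outbidRule hX hmax hc p
  -- Scaled by 27, the revenue is 17M + 6P + 4Q, to be compared with twice the benchmark. Away from
  -- p, 17 ≥ 2 · 8 suffices. With one entry up and one down, 6C + 4(c s - C) = 2(C + 2 c s) is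
  -- tight.
  have hsum : ∑ t, (![17 / 27, 6 / 27, 4 / 27] : Fin 3 → ℝ≥0) t = 1 := by
    rw [Fin.sum_univ_three, ← NNReal.coe_inj]
    norm_num [Matrix.cons_val_two]
  have hrev : ∀ v, (OfferRule.mix hX.convex ![17 / 27, 6 / 27, 4 / 27] hsum ![M, P, Q]).revenue v
      = 17 / 27 * M.revenue v + 6 / 27 * P.revenue v + 4 / 27 * Q.revenue v := by
    intro v
    rw [OfferRule.revenue_mix, Fin.sum_univ_three]
    simp [Matrix.cons_val_zero, Matrix.cons_val_one]
  have hP : ∀ v, P.revenue v = OPT X (trimmed p v) := postedPredictionRule_revenue hX p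
  have hself : (OfferRule.mix hX.convex ![17 / 27, 6 / 27, 4 / 27] hsum ![M, P, Q]).revenue p
      = OPT X p := by
    rw [hrev, hP, trimmed_self, overrideRule_revenue_self, outbidRule_revenue_self]
    ring
  refine ⟨OfferRule.mix hX.convex _ hsum ![M, P, Q], hself, fun v => ?_⟩
  have hM0 := M.revenue_nonneg v
  have hP0 := P.revenue_nonneg v
  have hQ0 := Q.revenue_nonneg v
  by_cases h0 : v = p
  · subst h0
    rw [hself]
    rw [hP, trimmed_self] at hP0
    have := EFO2_le_of_le hX hmax hn v v ∅ fun _ _ => le_rfl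
    simp only [Finset.card_empty, Nat.cast_zero, zero_mul, add_zero] at this
    linarith
  rw [hrev]
  by_cases h1 : ∃ i, OthersAgree p i v
  · obtain ⟨i, hi⟩ := h1
    have hq : ∀ k, k ≠ i → trimmed p v k = v k := by
      intro k hk
      simp [trimmed, hi k hk]
    have hB := EFO2_le_of_le hX hmax hn v (trimmed p v) {i}
      fun l hl => (hq l (by simpa using hl)).ge
    -- Some bidder other than `i` has value at least s and bids as predicted, so c s ≤ C and the
    -- benchmark is at most 2C.
    obtain ⟨k, hki, hk⟩ := exists_ne_second_le hn v i
    have hck := mul_le_OPT hX hc (trimmed p v) k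
    rw [hq k hki] at hck
    have hk' : (sortDesc v ⟨1, hn⟩ : ℝ) ≤ v k := by exact_mod_cast hk
    have := mul_le_mul_of_nonneg_left hk' c.2
    simp only [Finset.card_singleton, Nat.cast_one, one_mul, NNReal.val_eq_coe] at hB this
    rw [← hP] at hB hck
    linarith
  by_cases h2 : ∃ i j, i ≠ j ∧ p i < v i ∧ v j < p j ∧ ∀ k, k ≠ i → k ≠ j → v k = p k
  · obtain ⟨i, j, hij, hi, hj, hk⟩ := h2
    have hB := EFO2_le_of_le hX hmax hn v (trimmed p v) {i, j} fun l hl => by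
      simp only [Finset.mem_insert, Finset.mem_singleton, not_or] at hl
      simp [trimmed, hk l hl.1 hl.2]
    rw [Finset.card_pair hij] at hB
    have hQ : _ ≤ Q.revenue v := le_outbidRule_revenue hX hmax hc hn p v hij hi hj hk
    rw [← hP] at hB hQ
    push_cast at hB
    linarith
  · have hM : R₀.revenue v ≤ M.revenue v := by
      -- A bidder who sees exactly one other up must itself be up: being below gives the excluded
      -- up-down pair, and being equal means that only `j` deviates.
      refine revenue_le_overrideRule hX p R₀ v (fun i hi => h1 ⟨i, hi⟩) fun i => ?_
      rintro ⟨j, hji, hj, hk⟩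
      by_contra hle
      rcases (not_lt.mp hle).lt_or_eq with h | h
      · exact h2 ⟨j, i, hji, hj, h, fun k hkj hki => hk k hki hkj⟩
      · refine h1 ⟨j, fun k hkj => ?_⟩
        by_cases hki : k = i
        · rw [hki, h]
        · exact hk k hki hkj
    have := hR₀ v
    linarith

end CompetitiveAuction

theorem mainTheorem5 {n : ℕ} (hn : 2 ≤ n) (X : Set (Fin n → ℝ))
    (hX : CompetitiveAuction.IsPermutationEnvironment X) :
    ∃ M : CompetitiveAuction.PredMechanism X,
      M.IsTruthful ∧
      M.IsConsistent 1 (CompetitiveAuction.OPT X) ∧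
      M.IsRobust 13.5 (CompetitiveAuction.EFO2 hn X) := by
  choose R hself hrob using CompetitiveAuction.exists_prediction_rule hn hX
  refine ⟨fun p => (R p).toRand, fun p _ => (R p).toDet_isTruthful, fun p => ?_, fun p v => ?_⟩
  · rw [div_one, CompetitiveAuction.OfferRule.toRand_revenue, hself]
  · have := hrob p v
    rw [CompetitiveAuction.OfferRule.toRand_revenue, div_le_iff₀ (by norm_num)]
    linarith
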